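/- Let $\mathcal E$ be an exact category in the sense of Quillen, and let $\mathcal M\subseteq\mathcal E$ be a full subcategory closed under isomorphisms, finite direct sums and retracts. Write $\operatorname{Ext}^i$ for the Yoneda extension groups of $\mathcal E$. Let $F_{\mathcal M}$ be the exact structure on $\mathcal E$ whose conflations are the conflations of $\mathcal E$ that remain exact under $\operatorname{Hom}(M,-)$ for every $M\in\mathcal M$, and write $\operatorname{Ext}^i_{F_{\mathcal M}}$ for its Yoneda extension groups. For $k\ge 0$ put $${}^{\perp_k}\mathcal M=\{Y\in\mathcal E\mid \operatorname{Ext}^i(Y,M)=0\ \ \forall M\in\mathcal M,\ 1\le i\le k\},\qquad \mathcal M^{\perp_k}=\{Y\in\mathcal E\mid \operatorname{Ext}^i(M,Y)=0\ \ \forall M\in\mathcal M,\ 1\le i\le k\}.$$ The subcategory $\mathcal M$ is called generating (cogenerating) if every object of $\mathcal E$ admits a deflation from (an inflation into) an object of $\mathcal M$; functorially finite if every object of $\mathcal E$ has a right and a left $\mathcal M$-approximation; and $n$-rigid if $\operatorname{Ext}^i(M,M')=0$ for all $M,M'\in\mathcal M$ and $0<i<n$. The subcategory $\mathcal M$ is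 called $n$-precluster tilting if 1. it is generating, cogenerating, functorially finite and $n$-rigid; 2. $\operatorname{Ext}^i_{F_{\mathcal M}}(X,M)=0$ for all $X\in\mathcal E$, $M\in\mathcal M$ and $i\ge n$ (that is, $\operatorname{id}_{F_{\mathcal M}}M<n$); 3. it is cotilting in the exact category $(\mathcal E,F_{\mathcal M})$, i.e. it is functorially finite, there is a $k\ge 0$ with $\operatorname{Ext}^i_{F_{\mathcal M}}(X,M)=0$ for all $X\in\mathcal E$, $M\in\mathcal M$ and $i>k$, and, with ${}^{\perp_{F_{\mathcal M}}}\mathcal M=\{X\in\mathcal E\mid\operatorname{Ext}^i_{F_{\mathcal M}}(X,M)=0\ \ \forall M\in\mathcal M,\ i>0\}$, one has $\mathcal M\subseteq{}^{\perp_{F_{\mathcal M}}}\mathcal M$ and for each $X\in{}^{\perp_{F_{\mathcal M}}}\mathcal M$ there is an $F_{\mathcal M}$-conflation $X\rightarrowtail M\twoheadrightarrow X'$ with $M\in\mathcal M$ and $X'\in{}^{\perp_{F_{\mathcal M}}}\mathcal M$. **Proposition.** Let $n>1$ and let $\mathcal M$ be generating, cogenerating, functorially finite and $n$-rigid. Then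 ${}^{\perp_{n-1}}\mathcal M=\mathcal M^{\perp_{n-1}}$ if and only if $\mathcal M$ is $n$-precluster tilting. -/

import Mathlib

open CategoryTheory CategoryTheory.Limits

universe v u

section ExactStructures

variable {C : Type u} [Category.{v} C] [Preadditive C]

/-- Relative to a class `K` of short complexes `A ⟶ B ⟶ Z`, a morphism is an inflation if it is
the first map of a member of `K`. -/
def IsInflationFor (K : ObjectProperty (ShortComplex C)) {A B : C} (f : A ⟶ B) : Prop :=
  ∃ (Z : C) (g : B ⟶ Z) (w : f ≫ g = 0), K (ShortComplex.mk f g w)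

/-- Relative to a class `K` of short complexes `A ⟶ B ⟶ Z`, a morphism is a deflation if it is
the second map of a member of `K`. -/
def IsDeflationFor (K : ObjectProperty (ShortComplex C)) {B Z : C} (g : B ⟶ Z) : Prop :=
  ∃ (A : C) (f : A ⟶ B) (w : f ≫ g = 0), K (ShortComplex.mk f g w)

variable (C) in
/-- A Quillen exact structure on an additive category: a class of kernel-cokernel pairs, closed
under isomorphism, satisfying the usual axioms [E0], [E1], [E2] and their duals. -/
structure ExactStructure where
  /-- the conflations (admissible short exact sequences) -/
  conflation : ObjectProperty (ShortComplex C)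
  conflation_of_iso : ∀ {S T : ShortComplex C}, (S ≅ T) → conflation S → conflation T
  isKernel : ∀ {S : ShortComplex C}, conflation S →
    Nonempty (IsLimit (KernelFork.ofι S.f S.zero))
  isCokernel : ∀ {S : ShortComplex C}, conflation S →
    Nonempty (IsColimit (CokernelCofork.ofπ S.g S.zero))
  inflation_id : ∀ A : C, IsInflationFor conflation (𝟙 A)
  deflation_id : ∀ A : C, IsDeflationFor conflation (𝟙 A)
  inflation_comp : ∀ {A B D : C} (f : A ⟶ B) (g : B ⟶ D),
    IsInflationFor conflation f → IsInflationFor conflation g → IsInflationFor conflation (f ≫ g)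
  deflation_comp : ∀ {A B D : C} (f : A ⟶ B) (g : B ⟶ D),
    IsDeflationFor conflation f → IsDeflationFor conflation g → IsDeflationFor conflation (f ≫ g)
  inflation_pushout : ∀ {A B A' : C} (i : A ⟶ B) (f : A ⟶ A'), IsInflationFor conflation i →
    ∃ (P : C) (f' : B ⟶ P) (i' : A' ⟶ P), IsPushout i f f' i' ∧ IsInflationFor conflation i'
  deflation_pullback : ∀ {B Z Z' : C} (p : B ⟶ Z) (f : Z' ⟶ Z), IsDeflationFor conflation p →
    ∃ (P : C) (f' : P ⟶ B) (p' : P ⟶ Z'), IsPullback f' p' p f ∧ IsDeflationFor conflation p'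

namespace ExactStructure

variable (E : ExactStructure C)

/-- An inflation (admissible monomorphism). -/
def IsInflation {A B : C} (f : A ⟶ B) : Prop := IsInflationFor E.conflation f

/-- A deflation (admissible epimorphism). -/
def IsDeflation {A B : C} (f : A ⟶ B) : Prop := IsDeflationFor E.conflation f

/-! ### The relative exact structure -/

/-- A conflation `A ⟶ B ⟶ Z` stays exact under `Hom(X, -)` for all `X` in `M`. Since `A ⟶ B` is a
kernel of `B ⟶ Z`, this only says that `Hom(X, B) ⟶ Hom(X, Z)` is onto. -/
def relConflation (M : ObjectProperty C) : ObjectProperty (ShortComplex C) := fun S =>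
  E.conflation S ∧ ∀ X : C, M X → Function.Surjective (fun h : X ⟶ S.X₂ => h ≫ S.g)

/-- The relative exact structure `F_M`: the conflations that stay exact under `Hom(X, -)` for all
`X` in `M`. -/
def relative (M : ObjectProperty C) : ExactStructure C where
  conflation := E.relConflation M
  conflation_of_iso := by
    intro S T e hS
    refine ⟨E.conflation_of_iso e hS.1, fun X hX x => ?_⟩
    obtain ⟨y, hy⟩ := hS.2 X hX (x ≫ e.inv.τ₃)
    refine ⟨y ≫ e.hom.τ₂, ?_⟩
    simp only at hy ⊢
    rw [Category.assoc, e.hom.comm₂₃, ← Category.assoc, hy, Category.assoc,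
      ← ShortComplex.comp_τ₃, e.inv_hom_id, ShortComplex.id_τ₃, Category.comp_id]
  isKernel := fun h => E.isKernel h.1
  isCokernel := fun h => E.isCokernel h.1
  inflation_id := by
    intro A
    obtain ⟨Z, g, w, h⟩ := E.inflation_id A
    refine ⟨Z, g, w, h, fun X _ x => ⟨0, ?_⟩⟩
    have hg : g = 0 := by simpa using w
    obtain ⟨c⟩ := E.isCokernel h
    have hZ : 𝟙 Z = 0 := by
      apply Cofork.IsColimit.hom_ext c
      simp [hg]
    simp only [zero_comp]
    rw [← Category.comp_id x]
    exact (by rw [show (𝟙 Z : Z ⟶ Z) = 0 from hZ]; simp)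
  deflation_id := by
    intro A
    obtain ⟨Z, g, w, h⟩ := E.deflation_id A
    exact ⟨Z, g, w, h, fun X _ x => ⟨x, Category.comp_id x⟩⟩
  inflation_comp := by
    rintro A B D f g ⟨Z, p, w, h, hl⟩ ⟨W, q, w', h', hl'⟩
    obtain ⟨Q, r, wr, hr⟩ := E.inflation_comp f g ⟨Z, p, w, h⟩ ⟨W, q, w', h'⟩
    refine ⟨Q, r, wr, hr, fun X hX x => ?_⟩
    obtain ⟨P, a, b, sq, U, t, wt, ht⟩ := E.inflation_pushout g p ⟨W, q, w', h'⟩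
    obtain ⟨cp⟩ := E.isCokernel h
    obtain ⟨cr⟩ := E.isCokernel hr
    obtain ⟨kb⟩ := E.isKernel ht
    obtain ⟨cq⟩ := E.isCokernel h'
    obtain ⟨d, hd⟩ := CokernelCofork.IsColimit.desc' cr a (by
      change (f ≫ g) ≫ a = 0
      rw [Category.assoc, sq.w, ← Category.assoc]
      rw [w, zero_comp])
    obtain ⟨e, he⟩ := CokernelCofork.IsColimit.desc' cp (g ≫ r) (by
      change f ≫ g ≫ r = 0
      rw [← Category.assoc]; exact wr)
    obtain ⟨s, hs⟩ := CokernelCofork.IsColimit.desc' cq (a ≫ t) (by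
      change g ≫ a ≫ t = 0
      rw [← Category.assoc, sq.w, Category.assoc]
      rw [wt, comp_zero])
    simp only [Cofork.π_ofπ] at hd he hs
    have hpr : r ≫ d ≫ sq.desc r e he.symm = r := by
      rw [← Category.assoc, hd, sq.inl_desc]
    have hid : d ≫ sq.desc r e he.symm = 𝟙 Q := by
      apply Cofork.IsColimit.hom_ext cr
      simp only [Cofork.π_ofπ]
      rw [hpr]
      exact (Category.comp_id r).symm
    obtain ⟨k, hk⟩ := CokernelCofork.IsColimit.desc' cr q (by
      change (f ≫ g) ≫ q = 0
      rw [Category.assoc]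
      rw [w', comp_zero])
    simp only [Cofork.π_ofπ] at hk
    obtain ⟨y, hy⟩ := hl' X hX (x ≫ k)
    simp only at hy
    have hks : k ≫ s = d ≫ t := by
      apply Cofork.IsColimit.hom_ext cr
      simp only [Cofork.π_ofπ]
      rw [← Category.assoc, hk, hs, ← Category.assoc, hd]
    obtain ⟨z, hz⟩ := KernelFork.IsLimit.lift' kb ((x - y ≫ r) ≫ d) (by
      change ((x - y ≫ r) ≫ d) ≫ t = 0
      rw [Category.assoc, ← hks, ← Category.assoc, Preadditive.sub_comp, ← hy, Category.assoc,
        hk, sub_self, zero_comp])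
    simp only [Fork.ι_ofι] at hz
    obtain ⟨z', hz'⟩ := hl X hX z
    simp only at hz'
    refine ⟨y + z' ≫ g, ?_⟩
    simp only
    have h1 : x - y ≫ r = z' ≫ g ≫ r := by
      calc x - y ≫ r = ((x - y ≫ r) ≫ d) ≫ sq.desc r e he.symm := by
            rw [Category.assoc, hid, Category.comp_id]
        _ = z ≫ e := by rw [← hz, Category.assoc, sq.inr_desc]
        _ = z' ≫ g ≫ r := by rw [← hz', Category.assoc, he]
    rw [Preadditive.add_comp, Category.assoc, ← h1]
    abel
  deflation_comp := by
    rintro A B D f g ⟨Z, p, w, h, hl⟩ ⟨W, q, w', h', hl'⟩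
    obtain ⟨Q, r, wr, hr⟩ := E.deflation_comp f g ⟨Z, p, w, h⟩ ⟨W, q, w', h'⟩
    refine ⟨Q, r, wr, hr, fun X hX x => ?_⟩
    obtain ⟨y, hy⟩ := hl' X hX x
    obtain ⟨z, hz⟩ := hl X hX y
    refine ⟨z, ?_⟩
    simp only at hy hz ⊢
    rw [← Category.assoc, hz, hy]
  inflation_pushout := by
    rintro A B A' i f ⟨Z, p, w, h, hl⟩
    obtain ⟨P, f', i', sq, U, t, wt, ht⟩ := E.inflation_pushout i f ⟨Z, p, w, h⟩
    refine ⟨P, f', i', sq, U, t, wt, ht, fun X hX x => ?_⟩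
    obtain ⟨cp⟩ := E.isCokernel h
    obtain ⟨ct⟩ := E.isCokernel ht
    obtain ⟨a, ha⟩ := CokernelCofork.IsColimit.desc' cp (f' ≫ t) (by
      change i ≫ f' ≫ t = 0
      rw [← Category.assoc, sq.w, Category.assoc, wt, comp_zero])
    obtain ⟨b, hb⟩ := CokernelCofork.IsColimit.desc' ct (sq.desc p 0 (by rw [w, comp_zero]))
      (by exact sq.inr_desc _ _ _)
    simp only [Cofork.π_ofπ] at ha hb
    have hba : b ≫ a = 𝟙 U := by
      apply Cofork.IsColimit.hom_ext ct
      simp only [Cofork.π_ofπ]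
      rw [← Category.assoc, hb]
      refine Eq.trans ?_ (Category.comp_id t).symm
      apply sq.hom_ext
      · rw [← Category.assoc, sq.inl_desc, ha]
      · rw [← Category.assoc, sq.inr_desc, zero_comp, wt]
    obtain ⟨y, hy⟩ := hl X hX (x ≫ b)
    refine ⟨y ≫ f', ?_⟩
    simp only at hy ⊢
    rw [Category.assoc, ← ha, ← Category.assoc, hy, Category.assoc, hba]
    exact Category.comp_id x
  deflation_pullback := by
    rintro B Z Z' p f ⟨A, i, w, h, hl⟩
    obtain ⟨P, f', p', sq, K, t, wt, ht⟩ := E.deflation_pullback p f ⟨A, i, w, h⟩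
    refine ⟨P, f', p', sq, K, t, wt, ht, fun X hX x => ?_⟩
    obtain ⟨y, hy⟩ := hl X hX (x ≫ f)
    exact ⟨sq.lift y x hy, sq.lift_snd _ _ _⟩

/-! ### Yoneda extension groups -/

/-- A conflation `Y ⟶ mid ⟶ X` with prescribed ends. -/
structure ShortExtension (X Y : C) where
  mid : C
  i : Y ⟶ mid
  p : mid ⟶ X
  w : i ≫ p = 0
  conflation : E.conflation (ShortComplex.mk i p w)

/-- `n`-fold extensions of `X` by `Y`: for `n ≥ 1` the admissible exact sequences
`0 ⟶ Y ⟶ Aₙ ⟶ ⋯ ⟶ A₁ ⟶ X ⟶ 0`, recorded as the splicing of `n` conflations (so `Z` is the image of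
the first map between middle terms); for `n = 0` the morphisms `X ⟶ Y`. -/
def Extension : ℕ → C → C → Type (max u v)
  | 0, X, Y => ULift.{u} (X ⟶ Y)
  | 1, X, Y => E.ShortExtension X Y
  | n + 2, X, Y => Σ Z : C, E.ShortExtension Z Y × Extension (n + 1) X Z

/-- There is a morphism of exact sequences from `ξ` to `ξ'` that is `b : Y ⟶ Y'` on the left end
and the identity on the right end `X`. -/
def Extension.Maps : ∀ (n : ℕ) {X Y Y' : C}, (Y ⟶ Y') →
    E.Extension n X Y → E.Extension n X Y' → Prop
  | 0, _, _, _, b, ξ, ξ' => ξ.down ≫ b = ξ'.down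
  | 1, _, _, _, b, ξ, ξ' => ∃ m : ξ.mid ⟶ ξ'.mid, ξ.i ≫ m = b ≫ ξ'.i ∧ m ≫ ξ'.p = ξ.p
  | n + 2, _, _, _, b, ⟨Z, ζ, ξ⟩, ⟨Z', ζ', ξ'⟩ =>
      ∃ (m : ζ.mid ⟶ ζ'.mid) (c : Z ⟶ Z'), ζ.i ≫ m = b ≫ ζ'.i ∧ m ≫ ζ'.p = ζ.p ≫ c ∧
        Extension.Maps (n + 1) c ξ ξ'

/-- The underlying set of the Yoneda group `Ext^n(X, Y)` of the exact category: `n`-fold extensions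
modulo the equivalence relation generated by the morphisms that are the identity on both ends. -/
def Ext (n : ℕ) (X Y : C) : Type (max u v) :=
  Quot (fun ξ ξ' : E.Extension n X Y => Extension.Maps E n (𝟙 Y) ξ ξ')

/-- `Ext^n(X, Y) = 0`, i.e. the group has only one element. -/
def ExtVanishes (n : ℕ) (X Y : C) : Prop := Subsingleton (E.Ext n X Y)

/-- The injective dimension of `T` is strictly less than `n`: `Ext^i(-, T) = 0` for `i ≥ n`. -/
def HasInjDimLT (T : C) (n : ℕ) : Prop := ∀ i : ℕ, n ≤ i → ∀ X : C, E.ExtVanishes i X T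

/-! ### Orthogonal subcategories -/

/-- The objects `Y` with `Ext^i(Y, X) = 0` for all `X` in `M` and `1 ≤ i ≤ k`. -/
def leftPerp (k : ℕ) (M : ObjectProperty C) : ObjectProperty C := fun Y =>
  ∀ X : C, M X → ∀ i : ℕ, 1 ≤ i → i ≤ k → E.ExtVanishes i Y X

/-- The objects `Y` with `Ext^i(X, Y) = 0` for all `X` in `M` and `1 ≤ i ≤ k`. -/
def rightPerp (k : ℕ) (M : ObjectProperty C) : ObjectProperty C := fun Y =>
  ∀ X : C, M X → ∀ i : ℕ, 1 ≤ i → i ≤ k → E.ExtVanishes i X Y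

/-- The objects `Y` with `Ext^i(Y, X) = 0` for all `X` in `M` and all `i > 0`. -/
def leftPerpInf (M : ObjectProperty C) : ObjectProperty C := fun Y =>
  ∀ X : C, M X → ∀ i : ℕ, 1 ≤ i → E.ExtVanishes i Y X

end ExactStructure

/-! ### Subcategories -/

/-- A full subcategory closed under isomorphisms, finite direct sums and retracts. -/
structure IsAdditiveSubcategory [HasBinaryBiproducts C] (M : ObjectProperty C) : Prop where
  of_iso : ∀ {X Y : C}, (X ≅ Y) → M X → M Y
  zero : ∀ X : C, IsZero X → M X
  biprod : ∀ {X Y : C}, M X → M Y → M (X ⊞ Y)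
  of_retract : ∀ {X Y : C}, Retract X Y → M Y → M X

/-- Every object has a right `M`-approximation. -/
def IsContravariantlyFinite (M : ObjectProperty C) : Prop :=
  ∀ X : C, ∃ (A : C) (f : A ⟶ X), M A ∧ ∀ (B : C), M B → ∀ g : B ⟶ X, ∃ h : B ⟶ A, h ≫ f = g

/-- Every object has a left `M`-approximation. -/
def IsCovariantlyFinite (M : ObjectProperty C) : Prop :=
  ∀ X : C, ∃ (A : C) (f : X ⟶ A), M A ∧ ∀ (B : C), M B → ∀ g : X ⟶ B, ∃ h : A ⟶ B, f ≫ h = g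

/-- Contravariantly and covariantly finite. -/
def IsFunctoriallyFinite (M : ObjectProperty C) : Prop :=
  IsContravariantlyFinite M ∧ IsCovariantlyFinite M

namespace ExactStructure

variable (E : ExactStructure C)

/-- Every object is the target of a deflation from an object of `M`. -/
def IsGenerating (M : ObjectProperty C) : Prop :=
  ∀ X : C, ∃ (A : C) (p : A ⟶ X), M A ∧ E.IsDeflation p

/-- Every object is the source of an inflation into an object of `M`. -/
def IsCogenerating (M : ObjectProperty C) : Prop :=
  ∀ X : C, ∃ (A : C) (i : X ⟶ A), M A ∧ E.IsInflation i

/-- `Ext^i(M, M) = 0` for `0 < i < n`. -/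
def IsRigid (n : ℕ) (M : ObjectProperty C) : Prop :=
  ∀ i : ℕ, 0 < i → i < n → ∀ X Y : C, M X → M Y → E.ExtVanishes i X Y

/-- `k`-cotilting subcategories of an exact category (possibly without enough injectives). -/
structure IsCotilting (k : ℕ) (M : ObjectProperty C) : Prop where
  functoriallyFinite : IsFunctoriallyFinite M
  injDim_le : ∀ T : C, M T → E.HasInjDimLT T (k + 1)
  le_leftPerpInf : ∀ T : C, M T → E.leftPerpInf M T
  cogenerator : ∀ X : C, E.leftPerpInf M X → ∃ (T X' : C) (i : X ⟶ T) (p : T ⟶ X')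
    (w : i ≫ p = 0), E.conflation (ShortComplex.mk i p w) ∧ M T ∧ E.leftPerpInf M X'

/-- Partial `n`-precluster tilting subcategories. -/
structure IsPartialPreclusterTilting (n : ℕ) (M : ObjectProperty C) : Prop where
  generating : E.IsGenerating M
  cogenerating : E.IsCogenerating M
  contravariantlyFinite : IsContravariantlyFinite M
  covariantlyFinite : IsCovariantlyFinite M
  rigid : E.IsRigid n M
  relative_injDim_lt : ∀ T : C, M T → (E.relative M).HasInjDimLT T n

/-- `n`-precluster tilting subcategories: partial `n`-precluster tilting, and cotilting with respect
to the relative exact structure `F_M`. -/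
structure IsPreclusterTilting (n : ℕ) (M : ObjectProperty C) : Prop
    extends E.IsPartialPreclusterTilting n M where
  relative_cotilting : ∃ k : ℕ, (E.relative M).IsCotilting k M

end ExactStructure

end ExactStructures

/-! Write F for `E.relative M` and Ext_F for its extension groups. Objects of `M` are F-projective,
and since `M` is generating and contravariantly finite, every object has an F-deflation from `M`.
Two mechanisms carry the proof.

Trading orthogonality for degree: in an F-conflation K → N → X with N in `M`, rigidity makes K right
orthogonal to `M` in one more degree than X (`rightPerp_left`). In a conflation X → N → X', the
object X' loses one degree (`rightPerp_right`). Along F-conflations with N in `M`, Ext_F^i(K, T) and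
Ext_F^{i+1}(X, T) vanish together for i ≥ 1 (`extVanishes_shift`).

Comparison: conflations starting at an object Y with Ext^1(M, Y) = 0 are automatically
F-conflations. Induction on the degree then shows that left orthogonality to `M` in degrees below n
means the same for Ext and Ext_F (`leftPerp_of_relative`, `relative_leftPerp`).

If the two perpendicular categories agree, the (n-1)-st F-syzygy of any X is right orthogonal, hence
left orthogonal, so its Ext_F^1 into T in `M` vanishes; this is Ext_F^n(X, T) = 0. An X in the
F-perpendicular category is left, hence right, orthogonal, so an inflation that is a left
approximation of X gives an F-conflation, whose cokernel is again F-perpendicular: `M` is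
F-cotilting.

Conversely, a left orthogonal X is F-orthogonal in degrees below n by comparison and in the others
by the injective dimension. Cotilting then exhibits X as an iterated F-syzygy, which is right
orthogonal. For a right orthogonal X, n-1 cosyzygies push Ext_F^i(X, T) into degrees at least n,
where it vanishes.

Yoneda Ext is handled as a set with a base point: the covariant exact sequence and the computation
by projective resolutions are obtained without constructing its addition. -/

namespace ExactStructure

/-! ### Conflations, pushouts, pullbacks and direct sums in an exact category. -/

section Basic

variable {C : Type u} [Category.{v} C] [Preadditive C] {E : ExactStructure C}

namespace ShortExtension

variable {X Y : C} (ζ : E.ShortExtension X Y)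

lemma mono_i : Mono ζ.i :=
  ⟨fun _ _ h => Fork.IsLimit.hom_ext (E.isKernel ζ.conflation).some h⟩

lemma epi_p : Epi ζ.p :=
  ⟨fun _ _ h => Cofork.IsColimit.hom_ext (E.isCokernel ζ.conflation).some h⟩

lemma exists_lift {T : C} (f : T ⟶ ζ.mid) (hf : f ≫ ζ.p = 0) : ∃ g : T ⟶ Y, g ≫ ζ.i = f :=
  let l := KernelFork.IsLimit.lift' (E.isKernel ζ.conflation).some f hf
  ⟨l.1, l.2⟩

lemma exists_desc {T : C} (f : ζ.mid ⟶ T) (hf : ζ.i ≫ f = 0) : ∃ g : X ⟶ T, ζ.p ≫ g = f :=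
  let l := CokernelCofork.IsColimit.desc' (E.isCokernel ζ.conflation).some f hf
  ⟨l.1, l.2⟩

lemma isInflation : E.IsInflation ζ.i := ⟨_, ζ.p, ζ.w, ζ.conflation⟩

lemma isDeflation : E.IsDeflation ζ.p := ⟨_, ζ.i, ζ.w, ζ.conflation⟩

end ShortExtension

lemma IsDeflation.exists_shortExtension {B Z : C} {p : B ⟶ Z} (hp : E.IsDeflation p) :
    ∃ (A : C) (i : A ⟶ B) (w : i ≫ p = 0), E.conflation (ShortComplex.mk i p w) := hp

/-- A deflation together with a kernel is a conflation. -/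
lemma conflation_of_isDeflation {A B Z : C} {i : A ⟶ B} {p : B ⟶ Z} (w : i ≫ p = 0)
    (hp : E.IsDeflation p) (hi : Mono i)
    (hl : ∀ {T : C} (f : T ⟶ B), f ≫ p = 0 → ∃ g : T ⟶ A, g ≫ i = f) :
    E.conflation (ShortComplex.mk i p w) := by
  obtain ⟨A', i', w', h⟩ := hp
  let ζ : E.ShortExtension Z A' := ⟨B, i', p, w', h⟩
  obtain ⟨a, ha : a ≫ i' = i⟩ := ζ.exists_lift i w
  obtain ⟨b, hb⟩ := hl i' w'
  have : Mono i' := ζ.mono_i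
  refine E.conflation_of_iso (S := .mk i' p w') (T := .mk i p w)
    (ShortComplex.isoMk (Iso.mk b a ?_ ?_) (Iso.refl _) (Iso.refl _) ?_ ?_) h
  · rw [← cancel_mono i']; simp [ha, hb]
  · rw [← cancel_mono i]; simp [ha, hb]
  · simp [hb]
  · simp

/-- An inflation together with a cokernel is a conflation. -/
lemma conflation_of_isInflation {A B Z : C} {i : A ⟶ B} {p : B ⟶ Z} (w : i ≫ p = 0)
    (hi : E.IsInflation i) (hp : Epi p)
    (hl : ∀ {T : C} (f : B ⟶ T), i ≫ f = 0 → ∃ g : Z ⟶ T, p ≫ g = f) :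
    E.conflation (ShortComplex.mk i p w) := by
  obtain ⟨Z', p', w', h⟩ := hi
  let ζ : E.ShortExtension Z' A := ⟨B, i, p', w', h⟩
  obtain ⟨a, ha : p' ≫ a = p⟩ := ζ.exists_desc p w
  obtain ⟨b, hb⟩ := hl p' w'
  have : Epi p' := ζ.epi_p
  refine E.conflation_of_iso (S := .mk i p' w') (T := .mk i p w)
    (ShortComplex.isoMk (Iso.refl _) (Iso.refl _) (Iso.mk a b ?_ ?_) ?_ ?_) h
  · rw [← cancel_epi p']; simp [reassoc_of% ha, hb]
  · rw [← cancel_epi p]; simp [reassoc_of% hb, ha]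
  · simp
  · simp [ha]

lemma IsDeflation.comp {A B D : C} {f : A ⟶ B} {g : B ⟶ D} (hf : E.IsDeflation f)
    (hg : E.IsDeflation g) : E.IsDeflation (f ≫ g) := E.deflation_comp f g hf hg

lemma IsInflation.comp {A B D : C} {f : A ⟶ B} {g : B ⟶ D} (hf : E.IsInflation f)
    (hg : E.IsInflation g) : E.IsInflation (f ≫ g) := E.inflation_comp f g hf hg

variable (E) in
lemma isDeflation_of_iso {A B : C} (e : A ≅ B) : E.IsDeflation e.hom := by
  obtain ⟨K, f, w, h⟩ := E.deflation_id A
  have hf : f = 0 := by simpa using w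
  have w' : f ≫ e.hom = 0 := by simp [hf]
  refine ⟨K, f, w', E.conflation_of_iso (S := .mk f (𝟙 A) w) (T := .mk f e.hom w')
    (ShortComplex.isoMk (Iso.refl _) (Iso.refl _) e ?_ ?_) h⟩ <;> simp

variable (E) in
lemma isInflation_of_iso {A B : C} (e : A ≅ B) : E.IsInflation e.hom := by
  obtain ⟨K, f, w, h⟩ := E.inflation_id B
  have hf : f = 0 := by simpa using w
  have w' : e.hom ≫ f = 0 := by simp [hf]
  refine ⟨K, f, w', E.conflation_of_iso (S := .mk (𝟙 B) f w) (T := .mk e.hom f w')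
    (ShortComplex.isoMk e.symm (Iso.refl _) (Iso.refl _) ?_ ?_) h⟩ <;> simp

lemma IsDeflation.of_isPullback {P B Z Z' : C} {f' : P ⟶ B} {p' : P ⟶ Z'} {p : B ⟶ Z}
    {f : Z' ⟶ Z} (sq : IsPullback f' p' p f) (hp : E.IsDeflation p) : E.IsDeflation p' := by
  obtain ⟨Q, g', q', sq', hq⟩ := E.deflation_pullback p f hp
  have : p' = (sq.isoIsPullback _ _ sq').hom ≫ q' := by simp
  rw [this]
  exact (isDeflation_of_iso E _).comp hq

lemma IsInflation.of_isPushout {A B A' P : C} {i : A ⟶ B} {f : A ⟶ A'} {f' : B ⟶ P}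
    {i' : A' ⟶ P} (sq : IsPushout i f f' i') (hi : E.IsInflation i) : E.IsInflation i' := by
  obtain ⟨Q, g', q', sq', hq⟩ := E.inflation_pushout i f hi
  have : i' = q' ≫ (sq'.isoIsPushout _ _ sq).hom := by simp
  rw [this]
  exact IsInflation.comp hq (isInflation_of_iso E _)

-- The cokernel of an identity is a zero object, and zero objects are isomorphic.
variable (E) in
lemma isDeflation_to_zero (X : C) {Z : C} (hZ : IsZero Z) : E.IsDeflation (0 : X ⟶ Z) := by
  obtain ⟨W, g, w, h⟩ := E.inflation_id X
  have hg : g = 0 := by simpa using w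
  let ζ : E.ShortExtension W X := ⟨X, 𝟙 X, g, w, h⟩
  have : Epi g := ζ.epi_p
  have hW : IsZero W := by
    rw [IsZero.iff_id_eq_zero, ← cancel_epi g, hg]; simp
  have := IsDeflation.comp (E := E) ⟨_, _, w, h⟩ (isDeflation_of_iso E (hW.iso hZ))
  rwa [hZ.eq_of_tgt (g ≫ _) 0] at this

variable (E) in
lemma isInflation_from_zero (X : C) {Z : C} (hZ : IsZero Z) : E.IsInflation (0 : Z ⟶ X) := by
  obtain ⟨W, g, w, h⟩ := E.deflation_id X
  have hg : g = 0 := by simpa using w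
  let ζ : E.ShortExtension X W := ⟨X, g, 𝟙 X, w, h⟩
  have : Mono g := ζ.mono_i
  have hW : IsZero W := by
    rw [IsZero.iff_id_eq_zero, ← cancel_mono g, hg]; simp
  have := IsInflation.comp (isInflation_of_iso E (hZ.iso hW)) (E := E) ⟨_, _, w, h⟩
  rwa [hZ.eq_of_src (_ ≫ g) 0] at this

/-- In a morphism of conflations which is the identity on the left, the right square is a
pullback. -/
lemma ShortExtension.isPullback {X X' Y : C} (ζ : E.ShortExtension X Y)
    (ζ' : E.ShortExtension X' Y) {m : ζ.mid ⟶ ζ'.mid} {c : X ⟶ X'} (hi : ζ.i ≫ m = ζ'.i)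
    (hp : m ≫ ζ'.p = ζ.p ≫ c) : IsPullback m ζ.p ζ'.p c := by
  have joint : ∀ {T : C} (u : T ⟶ ζ.mid), u ≫ m = 0 → u ≫ ζ.p = 0 → u = 0 := by
    intro T u h1 h2
    obtain ⟨a, rfl⟩ := ζ.exists_lift u h2
    have := ζ'.mono_i
    have ha : a = 0 := by
      rw [← cancel_mono ζ'.i, ← hi, ← Category.assoc, h1, zero_comp]
    rw [ha, zero_comp]
  have key : ∀ {T : C} (x : T ⟶ ζ'.mid) (y : T ⟶ X), x ≫ ζ'.p = y ≫ c →
      ∃ w : T ⟶ ζ.mid, w ≫ m = x ∧ w ≫ ζ.p = y := by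
    intro T x y hxy
    -- The lift exists after base change along the deflation `t`: correct `b` by a map through `Y`
    -- so that it lies over `t ≫ x` as well. The corrected map kills the kernel of `t` by joint
    -- monicity, so it descends to `T`.
    obtain ⟨T', b, t, sq, K, k, wk, hk⟩ := E.deflation_pullback ζ.p y ζ.isDeflation
    let τ : E.ShortExtension T K := ⟨T', k, t, wk, hk⟩
    have hbt : b ≫ ζ.p = t ≫ y := sq.w
    obtain ⟨a, ha⟩ := ζ'.exists_lift (b ≫ m - t ≫ x) (by
      rw [Preadditive.sub_comp, Category.assoc, hp, reassoc_of% hbt, Category.assoc, hxy, sub_self])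
    have h1 : (b - a ≫ ζ.i) ≫ m = t ≫ x := by
      rw [Preadditive.sub_comp, Category.assoc, hi, ha]; abel
    have h2 : (b - a ≫ ζ.i) ≫ ζ.p = t ≫ y := by
      rw [Preadditive.sub_comp, Category.assoc, ζ.w, comp_zero, sub_zero, hbt]
    obtain ⟨w, hw : t ≫ w = _⟩ := τ.exists_desc (b - a ≫ ζ.i) (joint _
      (by rw [Category.assoc, h1]; change k ≫ t ≫ x = 0; rw [← Category.assoc, wk, zero_comp])
      (by rw [Category.assoc, h2]; change k ≫ t ≫ y = 0; rw [← Category.assoc, wk, zero_comp]))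
    have : Epi t := τ.epi_p
    refine ⟨w, ?_, ?_⟩
    · rw [← cancel_epi t, ← Category.assoc, hw, h1]
    · rw [← cancel_epi t, ← Category.assoc, hw, h2]
  refine ⟨⟨hp⟩, ⟨PullbackCone.IsLimit.mk hp (fun s => (key s.fst s.snd s.condition).choose)
    (fun s => (key s.fst s.snd s.condition).choose_spec.1)
    (fun s => (key s.fst s.snd s.condition).choose_spec.2) ?_⟩⟩
  intro s w h1 h2
  obtain ⟨h1', h2'⟩ := (key s.fst s.snd s.condition).choose_spec
  rw [← sub_eq_zero]
  apply joint
  · rw [Preadditive.sub_comp, h1, h1', sub_self]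
  · rw [Preadditive.sub_comp, h2, h2', sub_self]

/-- The pushout of a conflation along a morphism out of its left end. -/
lemma ShortExtension.exists_pushout {X Y Y' : C} (ζ : E.ShortExtension X Y) (b : Y ⟶ Y') :
    ∃ (ζ' : E.ShortExtension X Y') (m : ζ.mid ⟶ ζ'.mid),
      IsPushout ζ.i b m ζ'.i ∧ m ≫ ζ'.p = ζ.p := by
  obtain ⟨P, m, i', sq, hi⟩ := E.inflation_pushout ζ.i b ζ.isInflation
  have hmp := sq.inl_desc ζ.p (0 : Y' ⟶ X) (by rw [ζ.w, comp_zero])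
  have hip := sq.inr_desc ζ.p (0 : Y' ⟶ X) (by rw [ζ.w, comp_zero])
  have := ζ.epi_p
  refine ⟨⟨P, i', sq.desc ζ.p 0 (by rw [ζ.w, comp_zero]), hip,
    conflation_of_isInflation _ hi (epi_of_epi_fac hmp) ?_⟩, m, sq, hmp⟩
  intro T f hf
  obtain ⟨g, hg⟩ := ζ.exists_desc (m ≫ f) (by rw [reassoc_of% sq.w, hf, comp_zero])
  refine ⟨g, sq.hom_ext ?_ ?_⟩
  · rw [reassoc_of% hmp, hg]
  · rw [reassoc_of% hip, hf, zero_comp]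

/-- The pullback of a conflation along a morphism into its right end. -/
lemma ShortExtension.exists_pullback {X X' Y : C} (ζ : E.ShortExtension X Y) (a : X' ⟶ X) :
    ∃ (ζ' : E.ShortExtension X' Y) (m : ζ'.mid ⟶ ζ.mid),
      IsPullback m ζ'.p ζ.p a ∧ ζ'.i ≫ m = ζ.i := by
  obtain ⟨P, m, p', sq, hp⟩ := E.deflation_pullback ζ.p a ζ.isDeflation
  have hmp := sq.lift_fst ζ.i (0 : Y ⟶ X') (by rw [ζ.w, zero_comp])
  have hip := sq.lift_snd ζ.i (0 : Y ⟶ X') (by rw [ζ.w, zero_comp])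
  have := ζ.mono_i
  refine ⟨⟨P, sq.lift ζ.i 0 (by rw [ζ.w, zero_comp]), p', hip,
    conflation_of_isDeflation _ hp (mono_of_mono_fac hmp) ?_⟩, m, sq, hmp⟩
  intro T f hf
  obtain ⟨g, hg⟩ := ζ.exists_lift (f ≫ m) (by rw [Category.assoc, sq.w, reassoc_of% hf, zero_comp])
  refine ⟨g, sq.hom_ext ?_ ?_⟩
  · rw [Category.assoc, hmp, hg]
  · rw [Category.assoc, hip, hf, comp_zero]

section Biprod

variable [HasBinaryBiproducts C]

/-- Exhibits `𝟙 ⊕ p` as a base change of `p`, hence as a deflation whenever `p` is one. -/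
lemma isPullback_biprod_snd (A : C) {B X : C} (p : B ⟶ X) :
    IsPullback (biprod.snd : A ⊞ B ⟶ B) (biprod.map (𝟙 A) p) p biprod.snd := by
  refine ⟨⟨by simp⟩, ⟨PullbackCone.IsLimit.mk _
    (fun s => biprod.lift (s.snd ≫ biprod.fst) s.fst) (fun s => by simp) (fun s => ?_) ?_⟩⟩
  · apply biprod.hom_ext
    · simp
    · simpa using s.condition
  · intro s m h1 h2
    apply biprod.hom_ext
    · simp [← h2]
    · simp [← h1]

lemma IsDeflation.biprod_map {A B X Y : C} {p : A ⟶ X} {q : B ⟶ Y} (hp : E.IsDeflation p)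
    (hq : E.IsDeflation q) : E.IsDeflation (biprod.map p q) := by
  have : biprod.map p q = biprod.map (𝟙 A) q ≫ (biprod.braiding A Y).hom ≫
      biprod.map (𝟙 Y) p ≫ (biprod.braiding Y X).hom := by
    apply biprod.hom_ext <;> simp
  rw [this]
  exact (of_isPullback (isPullback_biprod_snd _ q) hq).comp ((isDeflation_of_iso E _).comp
    ((of_isPullback (isPullback_biprod_snd _ p) hp).comp (isDeflation_of_iso E _)))

variable [HasZeroObject C]

variable (E) in
lemma isDeflation_biprod_snd (A B : C) : E.IsDeflation (biprod.snd : A ⊞ B ⟶ B) :=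
  IsDeflation.of_isPullback (IsPullback.of_has_biproduct A B) (isDeflation_to_zero E A (isZero_zero C))

variable (E) in
lemma isInflation_biprod_inr (A B : C) : E.IsInflation (biprod.inr : B ⟶ A ⊞ B) :=
  IsInflation.of_isPushout (IsPushout.of_has_biproduct A B)
    (isInflation_from_zero E A (isZero_zero C))

lemma IsDeflation.biprod_desc {A B X : C} (f : A ⟶ X) {p : B ⟶ X} (hp : E.IsDeflation p) :
    E.IsDeflation (biprod.desc f p) := by
  -- The shear automorphism reduces the map to `𝟙 ⊕ p` followed by a projection.
  let e : A ⊞ X ≅ A ⊞ X := Iso.mk (biprod.lift biprod.fst (biprod.desc f (𝟙 X)))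
    (biprod.lift biprod.fst (biprod.desc (-f) (𝟙 X)))
    (by apply biprod.hom_ext <;> simp; apply biprod.hom_ext' <;> simp)
    (by apply biprod.hom_ext <;> simp; apply biprod.hom_ext' <;> simp)
  have : biprod.desc f p = biprod.map (𝟙 A) p ≫ e.hom ≫ biprod.snd := by
    apply biprod.hom_ext' <;> simp [e]
  rw [this]
  exact (of_isPullback (isPullback_biprod_snd A p) hp).comp ((isDeflation_of_iso E e).comp (isDeflation_biprod_snd E _ _))

lemma IsInflation.biprod_lift {A B X : C} (f : X ⟶ A) {i : X ⟶ B} (hi : E.IsInflation i) :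
    E.IsInflation (biprod.lift f i) := by
  have sq : IsPushout i (biprod.inr : X ⟶ A ⊞ X) (biprod.inr : B ⟶ A ⊞ B)
      (biprod.map (𝟙 A) i) := by
    refine ⟨⟨by simp⟩, ⟨PushoutCocone.IsColimit.mk _
      (fun s => biprod.desc (biprod.inl ≫ s.inr) s.inl) (fun s => by simp) (fun s => ?_) ?_⟩⟩
    · apply biprod.hom_ext'
      · simp
      · simpa using s.condition
    · intro s m h1 h2
      apply biprod.hom_ext'
      · simp [← h2]
      · simp [← h1]
  let e : A ⊞ X ≅ A ⊞ X := Iso.mk (biprod.lift (biprod.desc (𝟙 A) f) biprod.snd)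
    (biprod.lift (biprod.desc (𝟙 A) (-f)) biprod.snd)
    (by apply biprod.hom_ext <;> simp; apply biprod.hom_ext' <;> simp)
    (by apply biprod.hom_ext <;> simp; apply biprod.hom_ext' <;> simp)
  have : biprod.lift f i = biprod.inr ≫ e.hom ≫ biprod.map (𝟙 A) i := by
    apply biprod.hom_ext <;> simp [e]
  rw [this]
  exact (isInflation_biprod_inr E _ _).comp ((isInflation_of_iso E e).comp (of_isPushout sq hi))

end Biprod

end Basic

end ExactStructure

namespace ExactStructure

open scoped ZeroObject

/-! ### Yoneda extensions: covariant functoriality, connecting maps, base point and pairing. -/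

section ExtFunctor

variable {C : Type u} [Category.{v} C] [Preadditive C] {E : ExactStructure C}

namespace ShortExtension

/-- There is a morphism of conflations with prescribed maps on the left and right ends. -/
def Maps {X X' Y Y' : C} (b : Y ⟶ Y') (a : X ⟶ X') (ζ : E.ShortExtension X Y)
    (ζ' : E.ShortExtension X' Y') : Prop :=
  ∃ m : ζ.mid ⟶ ζ'.mid, ζ.i ≫ m = b ≫ ζ'.i ∧ m ≫ ζ'.p = ζ.p ≫ a

section

variable {X X' X'' Y Y' Y'' : C} {ζ : E.ShortExtension X Y} {ζ' : E.ShortExtension X' Y'}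
  {ζ'' : E.ShortExtension X'' Y''}

lemma Maps.refl (ζ : E.ShortExtension X Y) : Maps (𝟙 Y) (𝟙 X) ζ ζ :=
  ⟨𝟙 _, by simp, by simp⟩

lemma Maps.comp {b : Y ⟶ Y'} {a : X ⟶ X'} {b' : Y' ⟶ Y''} {a' : X' ⟶ X''} (h : Maps b a ζ ζ')
    (h' : Maps b' a' ζ' ζ'') : Maps (b ≫ b') (a ≫ a') ζ ζ'' := by
  obtain ⟨m, h1, h2⟩ := h
  obtain ⟨m', h1', h2'⟩ := h'
  exact ⟨m ≫ m', by rw [reassoc_of% h1, h1', Category.assoc],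
    by rw [Category.assoc, h2', reassoc_of% h2]⟩

/-- The pushout of a conflation. -/
noncomputable def push (ζ : E.ShortExtension X Y) (b : Y ⟶ Y') : E.ShortExtension X Y' :=
  (ζ.exists_pushout b).choose

/-- The morphism from a conflation to its pushout. -/
noncomputable def toPush (ζ : E.ShortExtension X Y) (b : Y ⟶ Y') : ζ.mid ⟶ (ζ.push b).mid :=
  (ζ.exists_pushout b).choose_spec.choose

lemma isPushout_push (ζ : E.ShortExtension X Y) (b : Y ⟶ Y') :
    IsPushout ζ.i b (ζ.toPush b) (ζ.push b).i :=
  (ζ.exists_pushout b).choose_spec.choose_spec.1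

lemma toPush_p (ζ : E.ShortExtension X Y) (b : Y ⟶ Y') : ζ.toPush b ≫ (ζ.push b).p = ζ.p :=
  (ζ.exists_pushout b).choose_spec.choose_spec.2

lemma maps_push (ζ : E.ShortExtension X Y) (b : Y ⟶ Y') : Maps b (𝟙 X) ζ (ζ.push b) :=
  ⟨ζ.toPush b, (ζ.isPushout_push b).w, by rw [toPush_p, Category.comp_id]⟩

/-- The universal property of the pushout, at the level of conflations; this is what makes `push`
well defined and functorial on classes. -/
lemma Maps.push {b : Y ⟶ Y'} {b' : Y' ⟶ Y''} {a : X ⟶ X''} (h : Maps (b ≫ b') a ζ ζ'') :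
    Maps b' a (ζ.push b) ζ'' := by
  obtain ⟨m, h1, h2⟩ := h
  have sq := ζ.isPushout_push b
  refine ⟨sq.desc m (b' ≫ ζ''.i) (by rw [h1, Category.assoc]), sq.inr_desc _ _ _, sq.hom_ext ?_ ?_⟩
  · rw [sq.inl_desc_assoc, h2, ← Category.assoc, toPush_p]
  · rw [sq.inr_desc_assoc, Category.assoc, ζ''.w, comp_zero, ← Category.assoc, (ζ.push b).w,
      zero_comp]

/-- The pullback of a conflation. -/
noncomputable def pull (ζ : E.ShortExtension X Y) (a : X' ⟶ X) : E.ShortExtension X' Y :=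
  (ζ.exists_pullback a).choose

/-- The morphism to a conflation from its pullback. -/
noncomputable def fromPull (ζ : E.ShortExtension X Y) (a : X' ⟶ X) : (ζ.pull a).mid ⟶ ζ.mid :=
  (ζ.exists_pullback a).choose_spec.choose

lemma isPullback_pull (ζ : E.ShortExtension X Y) (a : X' ⟶ X) :
    IsPullback (ζ.fromPull a) (ζ.pull a).p ζ.p a :=
  (ζ.exists_pullback a).choose_spec.choose_spec.1

lemma i_fromPull (ζ : E.ShortExtension X Y) (a : X' ⟶ X) : (ζ.pull a).i ≫ ζ.fromPull a = ζ.i :=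
  (ζ.exists_pullback a).choose_spec.choose_spec.2

lemma pull_maps (ζ : E.ShortExtension X Y) (a : X' ⟶ X) : Maps (𝟙 Y) a (ζ.pull a) ζ :=
  ⟨ζ.fromPull a, by rw [i_fromPull, Category.id_comp], (ζ.isPullback_pull a).w⟩

lemma Maps.pull {b : Y ⟶ Y''} {a : X ⟶ X'} {a' : X' ⟶ X''} (h : Maps b (a ≫ a') ζ ζ'') :
    Maps b a ζ (ζ''.pull a') := by
  obtain ⟨m, h1, h2⟩ := h
  have sq := ζ''.isPullback_pull a'
  refine ⟨sq.lift m (ζ.p ≫ a) (by rw [h2, Category.assoc]), sq.hom_ext ?_ ?_, sq.lift_snd _ _ _⟩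
  · rw [Category.assoc, sq.lift_fst, h1, Category.assoc, i_fromPull]
  · rw [Category.assoc, sq.lift_snd, Category.assoc, (ζ''.pull a').w, comp_zero, ← Category.assoc,
      ζ.w, zero_comp]

variable (E) in
/-- The conflation `0 ⟶ X ⟶ X`. -/
def ofSourceZero (X : C) {Z : C} (hZ : IsZero Z) : E.ShortExtension X Z where
  mid := X
  i := 0
  p := 𝟙 X
  w := by simp
  conflation := conflation_of_isDeflation _ (E.deflation_id X) ⟨fun _ _ _ => hZ.eq_of_tgt _ _⟩
    fun f hf => ⟨0, by simpa using hf.symm⟩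

end

section Biprod

variable [HasBinaryBiproducts C] {X X' X₁ Y Y' Y₁ : C}

/-- The direct sum of two conflations. -/
noncomputable def sum (ζ : E.ShortExtension X Y) (ζ' : E.ShortExtension X' Y') :
    E.ShortExtension (X ⊞ X') (Y ⊞ Y') where
  mid := ζ.mid ⊞ ζ'.mid
  i := biprod.map ζ.i ζ'.i
  p := biprod.map ζ.p ζ'.p
  w := by apply biprod.hom_ext <;> simp [ζ.w, ζ'.w]
  conflation := by
    have := ζ.mono_i
    have := ζ'.mono_i
    refine conflation_of_isDeflation _ (ζ.isDeflation.biprod_map ζ'.isDeflation) ⟨?_⟩ ?_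
    · intro T f g h
      apply biprod.hom_ext
      · rw [← cancel_mono ζ.i]; simpa using h =≫ biprod.fst
      · rw [← cancel_mono ζ'.i]; simpa using h =≫ biprod.snd
    · intro T f hf
      obtain ⟨g, hg⟩ := ζ.exists_lift (f ≫ biprod.fst) (by simpa using hf =≫ biprod.fst)
      obtain ⟨g', hg'⟩ := ζ'.exists_lift (f ≫ biprod.snd) (by simpa using hf =≫ biprod.snd)
      exact ⟨biprod.lift g g', by apply biprod.hom_ext <;> simp [hg, hg']⟩

lemma sum_maps_fst (ζ : E.ShortExtension X Y) (ζ' : E.ShortExtension X' Y') :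
    Maps biprod.fst biprod.fst (ζ.sum ζ') ζ :=
  ⟨biprod.fst, by simp [sum], by simp [sum]⟩

lemma sum_maps_snd (ζ : E.ShortExtension X Y) (ζ' : E.ShortExtension X' Y') :
    Maps biprod.snd biprod.snd (ζ.sum ζ') ζ' :=
  ⟨biprod.snd, by simp [sum], by simp [sum]⟩

lemma Maps.sum {ω : E.ShortExtension X₁ Y₁} {ζ : E.ShortExtension X Y}
    {ζ' : E.ShortExtension X' Y'} {b : Y₁ ⟶ Y} {b' : Y₁ ⟶ Y'} {a : X₁ ⟶ X} {a' : X₁ ⟶ X'}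
    (h : Maps b a ω ζ) (h' : Maps b' a' ω ζ') :
    Maps (biprod.lift b b') (biprod.lift a a') ω (ζ.sum ζ') := by
  obtain ⟨m, h1, h2⟩ := h
  obtain ⟨m', h1', h2'⟩ := h'
  refine ⟨biprod.lift m m', ?_, ?_⟩ <;> apply biprod.hom_ext <;>
    simp [ShortExtension.sum, h1, h1', h2, h2']

end Biprod

end ShortExtension

namespace Extension

open ShortExtension

section

variable {X Y Y' Y'' : C}

lemma maps_one_iff {b : Y ⟶ Y'} {ξ : E.Extension 1 X Y} {ξ' : E.Extension 1 X Y'} :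
    Maps E 1 b ξ ξ' ↔ ShortExtension.Maps (E := E) b (𝟙 X) ξ ξ' := by
  simp only [ShortExtension.Maps, Category.comp_id]
  rfl

lemma maps_succ_iff {n : ℕ} {b : Y ⟶ Y'} {ξ : E.Extension (n + 2) X Y}
    {ξ' : E.Extension (n + 2) X Y'} :
    Maps E (n + 2) b ξ ξ' ↔ ∃ c : ξ.1 ⟶ ξ'.1, ShortExtension.Maps b c ξ.2.1 ξ'.2.1 ∧
      Maps E (n + 1) c ξ.2.2 ξ'.2.2 := by
  constructor
  · rintro ⟨m, c, h1, h2, h3⟩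
    exact ⟨c, ⟨m, h1, h2⟩, h3⟩
  · rintro ⟨c, ⟨m, h1, h2⟩, h3⟩
    exact ⟨m, c, h1, h2, h3⟩

lemma Maps.refl : ∀ {n : ℕ} {X Y : C} (ξ : E.Extension n X Y), Maps E n (𝟙 Y) ξ ξ
  | 0, _, _, ξ => Category.comp_id ξ.down
  | 1, _, _, _ => maps_one_iff.2 (ShortExtension.Maps.refl _)
  | _ + 2, _, _, ξ => maps_succ_iff.2 ⟨𝟙 _, ShortExtension.Maps.refl _, Maps.refl ξ.2.2⟩

lemma Maps.comp : ∀ {n : ℕ} {X Y Y' Y'' : C} {b : Y ⟶ Y'} {b' : Y' ⟶ Y''}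
    {ξ : E.Extension n X Y} {ξ' : E.Extension n X Y'} {ξ'' : E.Extension n X Y''},
    Maps E n b ξ ξ' → Maps E n b' ξ' ξ'' → Maps E n (b ≫ b') ξ ξ''
  | 0, _, _, _, _, b, b', ξ, ξ', ξ'', h, h' => by
    change ξ.down ≫ b ≫ b' = ξ''.down
    rw [← Category.assoc, show ξ.down ≫ b = ξ'.down from h]
    exact h'
  | 1, _, _, _, _, _, _, _, _, _, h, h' => maps_one_iff.2 (by
    simpa using (maps_one_iff.1 h).comp (maps_one_iff.1 h'))
  | _ + 2, _, _, _, _, _, _, _, _, _, h, h' => by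
    obtain ⟨c, h1, h2⟩ := maps_succ_iff.1 h
    obtain ⟨c', h1', h2'⟩ := maps_succ_iff.1 h'
    exact maps_succ_iff.2 ⟨c ≫ c', h1.comp h1', h2.comp h2'⟩

/-- The pushforward of an extension along a morphism out of its left end. -/
noncomputable def push : ∀ {n : ℕ} {X Y Y' : C}, (Y ⟶ Y') → E.Extension n X Y → E.Extension n X Y'
  | 0, _, _, _, b, ξ => ⟨ξ.down ≫ b⟩
  | 1, _, _, _, b, ξ => ShortExtension.push (E := E) ξ b
  | _ + 2, _, _, _, b, ξ => ⟨ξ.1, ξ.2.1.push b, ξ.2.2⟩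

lemma maps_push : ∀ {n : ℕ} {X Y Y' : C} (b : Y ⟶ Y') (ξ : E.Extension n X Y),
    Maps E n b ξ (push b ξ)
  | 0, _, _, _, _, _ => rfl
  | 1, _, _, _, b, ξ => maps_one_iff.2 (ShortExtension.maps_push (E := E) ξ b)
  | _ + 2, _, _, _, b, ξ => maps_succ_iff.2 ⟨𝟙 _, ξ.2.1.maps_push b, Maps.refl _⟩

lemma Maps.push : ∀ {n : ℕ} {X Y Y' Y'' : C} {b : Y ⟶ Y'} {b' : Y' ⟶ Y''}
    {ξ : E.Extension n X Y} {ξ'' : E.Extension n X Y''},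
    Maps E n (b ≫ b') ξ ξ'' → Maps E n b' (Extension.push b ξ) ξ''
  | 0, _, _, _, _, _, _, _, _, h => (Category.assoc _ _ _).trans h
  | 1, _, _, _, _, _, _, _, _, h => maps_one_iff.2 (ShortExtension.Maps.push (maps_one_iff.1 h))
  | _ + 2, _, _, _, _, _, _, _, _, h => by
    obtain ⟨c, h1, h2⟩ := maps_succ_iff.1 h
    exact maps_succ_iff.2 ⟨c, h1.push, h2⟩

/-- An extension by a zero object. -/
def ofZero : ∀ (n : ℕ) (X : C) {Z : C}, IsZero Z → E.Extension n X Z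
  | 0, _, _, _ => ⟨0⟩
  | 1, X, _, hZ => ShortExtension.ofSourceZero E X hZ
  | n + 2, X, Z, hZ => ⟨Z, ShortExtension.ofSourceZero E Z hZ, ofZero (n + 1) X hZ⟩

end

section Biprod

variable [HasBinaryBiproducts C]

/-- The extension of `X` by `Y ⊞ Y'` with given components. -/
noncomputable def pair : ∀ {n : ℕ} {X Y Y' : C}, E.Extension n X Y → E.Extension n X Y' →
    E.Extension n X (Y ⊞ Y')
  | 0, _, _, _, ξ, ξ' => ⟨biprod.lift ξ.down ξ'.down⟩
  | 1, X, _, _, ξ, ξ' =>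
    ShortExtension.pull (ShortExtension.sum (E := E) ξ ξ') (biprod.lift (𝟙 X) (𝟙 X))
  | _ + 2, _, _, _, ξ, ξ' => ⟨ξ.1 ⊞ ξ'.1, ξ.2.1.sum ξ'.2.1, pair ξ.2.2 ξ'.2.2⟩

lemma pair_maps_fst : ∀ {n : ℕ} {X Y Y' : C} (ξ : E.Extension n X Y) (ξ' : E.Extension n X Y'),
    Maps E n biprod.fst (pair ξ ξ') ξ
  | 0, _, _, _, _, _ => biprod.lift_fst _ _
  | 1, X, _, _, ξ, ξ' => maps_one_iff.2 (by
    have := (ShortExtension.pull_maps (E := E) _ (biprod.lift (𝟙 X) (𝟙 X))).comp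
      (ShortExtension.sum_maps_fst ξ ξ')
    rwa [Category.id_comp, biprod.lift_fst] at this)
  | _ + 2, _, _, _, ξ, ξ' => maps_succ_iff.2
    ⟨biprod.fst, ShortExtension.sum_maps_fst _ _, pair_maps_fst ξ.2.2 ξ'.2.2⟩

lemma pair_maps_snd : ∀ {n : ℕ} {X Y Y' : C} (ξ : E.Extension n X Y) (ξ' : E.Extension n X Y'),
    Maps E n biprod.snd (pair ξ ξ') ξ'
  | 0, _, _, _, _, _ => biprod.lift_snd _ _
  | 1, X, _, _, ξ, ξ' => maps_one_iff.2 (by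
    have := (ShortExtension.pull_maps (E := E) _ (biprod.lift (𝟙 X) (𝟙 X))).comp
      (ShortExtension.sum_maps_snd ξ ξ')
    rwa [Category.id_comp, biprod.lift_snd] at this)
  | _ + 2, _, _, _, ξ, ξ' => maps_succ_iff.2
    ⟨biprod.snd, ShortExtension.sum_maps_snd _ _, pair_maps_snd ξ.2.2 ξ'.2.2⟩

lemma Maps.pair : ∀ {n : ℕ} {X Y Y' Y₁ : C} {b : Y₁ ⟶ Y} {b' : Y₁ ⟶ Y'}
    {ω : E.Extension n X Y₁} {ξ : E.Extension n X Y} {ξ' : E.Extension n X Y'},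
    Maps E n b ω ξ → Maps E n b' ω ξ' → Maps E n (biprod.lift b b') ω (Extension.pair ξ ξ')
  | 0, _, _, _, _, _, _, _, _, _, h, h' => by
    apply biprod.hom_ext
    · exact (by simp : _ = _).trans (h.trans (biprod.lift_fst _ _).symm)
    · exact (by simp : _ = _).trans (h'.trans (biprod.lift_snd _ _).symm)
  | 1, _, _, _, _, _, _, _, _, _, h, h' => maps_one_iff.2 (ShortExtension.Maps.pull (by
    simpa using (maps_one_iff.1 h).sum (maps_one_iff.1 h')))
  | _ + 2, _, _, _, _, _, _, _, _, _, h, h' => by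
    obtain ⟨c, h1, h2⟩ := maps_succ_iff.1 h
    obtain ⟨c', h1', h2'⟩ := maps_succ_iff.1 h'
    exact maps_succ_iff.2 ⟨biprod.lift c c', h1.sum h1', h2.pair h2'⟩

end Biprod

end Extension

namespace Ext

variable {n : ℕ} {X Y Y' Y'' : C}

/-- The class of an extension. -/
def mk (ξ : E.Extension n X Y) : E.Ext n X Y := Quot.mk _ ξ

@[elab_as_elim]
lemma ind {P : E.Ext n X Y → Prop} (h : ∀ ξ, P (mk ξ)) (x : E.Ext n X Y) : P x := Quot.ind h x

lemma sound {ξ ξ' : E.Extension n X Y} (h : Extension.Maps E n (𝟙 Y) ξ ξ') : mk ξ = mk ξ' :=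
  Quot.sound h

/-- Functoriality of `Ext` in the second variable. -/
noncomputable def push (b : Y ⟶ Y') : E.Ext n X Y → E.Ext n X Y' :=
  Quot.map (Extension.push b) fun ξ ξ' h => Extension.Maps.push (by
    simpa using h.comp (Extension.maps_push b ξ'))

lemma push_mk_eq {b : Y ⟶ Y'} {ξ : E.Extension n X Y} {ξ' : E.Extension n X Y'}
    (h : Extension.Maps E n b ξ ξ') : push b (mk ξ) = mk ξ' :=
  sound (Extension.Maps.push (by rwa [Category.comp_id]))

@[simp]
lemma push_id (x : E.Ext n X Y) : push (𝟙 Y) x = x := by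
  induction x using ind with | h ξ => exact push_mk_eq (Extension.Maps.refl ξ)

lemma push_comp (b : Y ⟶ Y') (b' : Y' ⟶ Y'') (x : E.Ext n X Y) :
    push (b ≫ b') x = push b' (push b x) := by
  induction x using ind with | h ξ =>
  exact push_mk_eq ((Extension.maps_push b ξ).comp (Extension.maps_push b' _))

lemma subsingleton_of_isZero : ∀ (n : ℕ) (X : C) {Z : C} (_ : IsZero Z), Subsingleton (E.Ext n X Z)
  | n, X, Z, hZ => by
    suffices h : ∀ x : E.Ext n X Z, x = mk (Extension.ofZero n X hZ) from
      ⟨fun x y => (h x).trans (h y).symm⟩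
    intro x
    induction x using ind with | h ξ =>
    match n with
    | 0 => exact sound (hZ.eq_of_tgt _ _)
    | 1 => exact sound ⟨ShortExtension.p (E := E) ξ, hZ.eq_of_src _ _, Category.comp_id _⟩
    | n + 2 =>
      have := subsingleton_of_isZero (n + 1) X hZ
      -- The leftmost conflation can be replaced by the trivial one at the cost of pushing the tail
      -- to the zero object, where induction applies.
      have h1 : (mk ξ : E.Ext (n + 2) X Z) = mk (n := n + 2)
          ⟨Z, ShortExtension.ofSourceZero E Z hZ, Extension.push 0 ξ.2.2⟩ :=
        sound (Extension.maps_succ_iff.2 ⟨0, ⟨0, hZ.eq_of_src _ _, hZ.eq_of_tgt _ _⟩,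
          Extension.maps_push _ _⟩)
      rw [h1]
      have h2 : (mk (Extension.push 0 ξ.2.2) : E.Ext (n + 1) X Z) = mk (Extension.ofZero _ _ hZ) :=
        Subsingleton.elim _ _
      exact congrArg (Quot.map (fun ω => (⟨Z, ShortExtension.ofSourceZero E Z hZ, ω⟩ :
        E.Extension (n + 2) X Z)) fun ω ω' h => Extension.maps_succ_iff.2
          ⟨𝟙 _, ShortExtension.Maps.refl _, h⟩) h2

/-- The connecting map of a conflation. -/
noncomputable def delta : ∀ {n : ℕ} {X Z Y : C} (_ : E.ShortExtension Z Y), E.Ext n X Z →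
    E.Ext (n + 1) X Y
  | 0, _, _, _, ζ => Quot.map (fun ξ => (ζ.pull ξ.down : E.ShortExtension _ _)) (by
      intro ξ ξ' h
      obtain rfl : ξ = ξ' := ULift.ext _ _ ((Category.comp_id _).symm.trans h)
      exact Extension.Maps.refl (n := 1) _)
  | _ + 1, _, Z, _, ζ => Quot.map (fun ξ => ⟨Z, ζ, ξ⟩) fun _ _ h => Extension.maps_succ_iff.2
      ⟨𝟙 _, ShortExtension.Maps.refl _, h⟩

/-- Naturality of the connecting map. -/
lemma push_delta {Z Z' : C} {ζ : E.ShortExtension Z Y} {ζ' : E.ShortExtension Z' Y'} {b : Y ⟶ Y'}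
    {c : Z ⟶ Z'} (h : ShortExtension.Maps b c ζ ζ') (x : E.Ext n X Z) :
    push b (delta ζ x) = delta ζ' (push c x) := by
  induction x using ind with | h ξ =>
  match n with
  | 0 =>
    refine push_mk_eq (n := 1) (Extension.maps_one_iff.2 (ShortExtension.Maps.pull ?_))
    have := (ζ.pull_maps ξ.down).comp h
    rw [Category.id_comp] at this ⊢
    exact this
  | n + 1 => exact push_mk_eq (n := n + 2) (Extension.maps_succ_iff.2 ⟨c, h, Extension.maps_push c ξ⟩)

/-- In degree one the class is the connecting image of the identity; in higher degrees this is the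
definition of a spliced extension. It is the entry point for every induction on the degree. -/
lemma exists_delta (x : E.Ext (n + 1) X Y) :
    ∃ (Z : C) (ζ : E.ShortExtension Z Y) (x' : E.Ext n X Z), x = delta ζ x' := by
  induction x using ind with | h ξ =>
  match n with
  | 0 =>
    refine ⟨X, ξ, mk (n := 0) ⟨𝟙 X⟩, ?_⟩
    exact sound (n := 1) (Extension.maps_one_iff.2 (ShortExtension.Maps.pull
      (by simpa using ShortExtension.Maps.refl (E := E) ξ)))
  | n + 1 => exact ⟨ξ.1, ξ.2.1, mk ξ.2.2, rfl⟩

section Zero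

variable [HasZeroObject C]

variable (E n X Y) in
/-- The class of the trivial extension. -/
noncomputable def zero : E.Ext n X Y := push 0 (mk (Extension.ofZero n X (isZero_zero C)))

/-- A zero morphism factors through the zero object, over which there is only one class. -/
lemma push_zero_hom (x : E.Ext n X Y) : push (0 : Y ⟶ Y') x = zero E n X Y' := by
  have := subsingleton_of_isZero (E := E) n X (isZero_zero C)
  rw [show (0 : Y ⟶ Y') = (0 : Y ⟶ 0) ≫ 0 by simp, push_comp]
  exact congrArg _ (Subsingleton.elim _ _)

@[simp]
lemma push_zero (b : Y ⟶ Y') : push b (zero E n X Y) = zero E n X Y' := by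
  rw [zero, ← push_comp, zero_comp, push_zero_hom]

@[simp]
lemma delta_zero {Z : C} (ζ : E.ShortExtension Z Y) : delta ζ (zero E n X Z) = zero E (n + 1) X Y := by
  have h : ShortExtension.Maps (0 : (0 : C) ⟶ Y) (0 : 0 ⟶ Z)
    (ShortExtension.ofSourceZero E 0 (isZero_zero C)) ζ := ⟨0, by simp, by simp⟩
  rw [← push_zero_hom (zero E n X 0), ← push_delta h, push_zero_hom]

/-- Naturality of the connecting map for the morphism to `ζ` from the trivial conflation ending in
`ζ.mid`. -/
lemma delta_push_p {Z : C} (ζ : E.ShortExtension Z Y) (x : E.Ext n X ζ.mid) :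
    delta ζ (push ζ.p x) = zero E (n + 1) X Y := by
  have h : ShortExtension.Maps (0 : (0 : C) ⟶ Y) ζ.p
    (ShortExtension.ofSourceZero E ζ.mid (isZero_zero C)) ζ :=
      ⟨𝟙 _, by simp [ShortExtension.ofSourceZero], by simp [ShortExtension.ofSourceZero]⟩
  rw [← push_delta h, push_zero_hom]

lemma _root_.ExactStructure.extVanishes_iff :
    E.ExtVanishes n X Y ↔ ∀ x : E.Ext n X Y, x = zero E n X Y :=
  ⟨fun h _ => h.elim _ _, fun h => ⟨fun x y => (h x).trans (h y).symm⟩⟩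

end Zero

section Pair

variable [HasBinaryBiproducts C]

/-- The class with given components. -/
noncomputable def pair (x : E.Ext n X Y) (y : E.Ext n X Y') : E.Ext n X (Y ⊞ Y') :=
  Quot.map₂ Extension.pair
    (fun ξ ω ω' h => by
      have := (Extension.pair_maps_fst ξ ω).pair ((Extension.pair_maps_snd ξ ω).comp h)
      rwa [Category.comp_id, show biprod.lift biprod.fst biprod.snd = 𝟙 (Y ⊞ Y') by
        apply biprod.hom_ext <;> simp] at this)
    (fun ξ ξ' ω h => by
      have := ((Extension.pair_maps_fst ξ ω).comp h).pair (Extension.pair_maps_snd ξ ω)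
      rwa [Category.comp_id, show biprod.lift biprod.fst biprod.snd = 𝟙 (Y ⊞ Y') by
        apply biprod.hom_ext <;> simp] at this) x y

lemma push_lift {Y₁ : C} (b : Y₁ ⟶ Y) (b' : Y₁ ⟶ Y') (x : E.Ext n X Y₁) :
    push (biprod.lift b b') x = pair (push b x) (push b' x) := by
  induction x using ind with | h ξ =>
  exact push_mk_eq ((Extension.maps_push b ξ).pair (Extension.maps_push b' ξ))

@[simp]
lemma push_fst_pair (x : E.Ext n X Y) (y : E.Ext n X Y') : push biprod.fst (pair x y) = x := by
  induction x using ind with | h ξ =>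
  induction y using ind with | h ω =>
  exact push_mk_eq (Extension.pair_maps_fst ξ ω)

@[simp]
lemma push_snd_pair (x : E.Ext n X Y) (y : E.Ext n X Y') : push biprod.snd (pair x y) = y := by
  induction x using ind with | h ξ =>
  induction y using ind with | h ω =>
  exact push_mk_eq (Extension.pair_maps_snd ξ ω)

/-- Stands in for subtracting classes: the two components become equal, so the pair is a diagonal
image, and the diagonal followed by the difference map is zero. -/
lemma push_desc_pair [HasZeroObject C] {f : Y ⟶ Y''} {g : Y' ⟶ Y''} {x : E.Ext n X Y}
    {y : E.Ext n X Y'} (h : push f x = push g y) :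
    push (biprod.desc f (-g)) (pair x y) = zero E n X Y'' := by
  have h1 : biprod.desc f (-g) = biprod.lift (biprod.fst ≫ f) (biprod.snd ≫ g) ≫
      biprod.desc (𝟙 _) (-𝟙 _) := by
    apply biprod.hom_ext' <;> simp [biprod.lift_desc]
  have h2 : push (biprod.lift (biprod.fst ≫ f) (biprod.snd ≫ g)) (pair x y) =
      push (biprod.lift (𝟙 _) (𝟙 _)) (push f x) := by
    rw [push_lift, push_lift, push_comp, push_comp, push_fst_pair, push_snd_pair, push_id, ← h]
  rw [h1, push_comp, h2, ← push_comp]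
  simpa using push_zero_hom _

lemma push_sub_eq_zero [HasZeroObject C] {f g : Y ⟶ Y'} {x : E.Ext n X Y}
    (h : push f x = push g x) : push (f - g) x = zero E n X Y' := by
  rw [← push_desc_pair h, show f - g = biprod.lift (𝟙 _) (𝟙 _) ≫ biprod.desc f (-g) by
    rw [biprod.lift_desc, Category.id_comp, Category.id_comp, sub_eq_add_neg], push_comp,
    push_lift, push_id]

end Pair

end Ext

end ExtFunctor

end ExactStructure

namespace ExactStructure

/-! ### The covariant long exact sequence and dimension shifts. -/

section Exactness

variable {C : Type u} [Category.{v} C] [Preadditive C] {E : ExactStructure C}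

namespace ShortExtension

variable {X Y Z : C}

/-- Pushing a conflation `B ⟶ D ⟶ W` forward along the deflation of `A ⟶ B ⟶ Z`, the composite
`A ⟶ D` is an inflation whose cokernel is the new middle term. -/
noncomputable def compPush {W B : C} (β : E.ShortExtension W B) {A : C} {i : A ⟶ B} {p : B ⟶ Z}
    {w : i ≫ p = 0} (h : E.conflation (ShortComplex.mk i p w)) :
    E.ShortExtension (β.push p).mid A where
  mid := β.mid
  i := i ≫ β.i
  p := β.toPush p
  w := by rw [Category.assoc, (β.isPushout_push p).w, reassoc_of% w, zero_comp]
  conflation := by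
    have sq := β.isPushout_push p
    let ζ : E.ShortExtension Z A := ⟨B, i, p, w, h⟩
    have hp : Epi p := ζ.epi_p
    refine conflation_of_isInflation _ (IsInflation.comp ζ.isInflation β.isInflation)
      ⟨fun f g h => sq.hom_ext h ?_⟩ fun f hf => ?_
    · rw [← cancel_epi p, ← sq.w_assoc, ← sq.w_assoc, h]
    · obtain ⟨g, hg⟩ := ζ.exists_desc (β.i ≫ f) (by rw [← hf, Category.assoc])
      exact ⟨sq.desc f g hg.symm, sq.inl_desc _ _ _⟩

/-- Pushing a conflation `A ⟶ D ⟶ W` forward along the inflation of `A ⟶ B ⟶ Z` gives a conflation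
`D ⟶ D' ⟶ Z`. -/
lemma exists_toPush_conflation {W A : C} (α : E.ShortExtension W A) (ζ : E.ShortExtension Z A) :
    ∃ (r : (α.push ζ.i).mid ⟶ Z) (w : α.toPush ζ.i ≫ r = 0),
      (α.push ζ.i).i ≫ r = ζ.p ∧ E.conflation (ShortComplex.mk (α.toPush ζ.i) r w) := by
  have sq := α.isPushout_push ζ.i
  have h1 := sq.inl_desc (0 : α.mid ⟶ Z) ζ.p (by rw [ζ.w, comp_zero])
  have h2 := sq.inr_desc (0 : α.mid ⟶ Z) ζ.p (by rw [ζ.w, comp_zero])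
  have := ζ.epi_p
  refine ⟨_, h1, h2, conflation_of_isInflation _ (IsInflation.of_isPushout sq.flip ζ.isInflation)
    (epi_of_epi_fac h2) fun f hf => ?_⟩
  obtain ⟨g, hg⟩ := ζ.exists_desc ((α.push ζ.i).i ≫ f) (by
    rw [← sq.w_assoc, hf, comp_zero])
  exact ⟨g, sq.hom_ext (by rw [reassoc_of% h1, zero_comp, hf]) (by rw [reassoc_of% h2, hg])⟩

variable (E) in
/-- Whether a conflation splits. -/
def Splits (ζ : E.ShortExtension X Y) : Prop := ∃ s : X ⟶ ζ.mid, s ≫ ζ.p = 𝟙 X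

lemma Splits.exists_retraction {ζ : E.ShortExtension X Y} (h : ζ.Splits) :
    ∃ r : ζ.mid ⟶ Y, ζ.i ≫ r = 𝟙 Y := by
  obtain ⟨s, hs⟩ := h
  obtain ⟨r, hr⟩ := ζ.exists_lift (𝟙 _ - ζ.p ≫ s) (by simp [hs])
  have := ζ.mono_i
  refine ⟨r, ?_⟩
  rw [← cancel_mono ζ.i, Category.assoc, hr, Preadditive.comp_sub, reassoc_of% ζ.w]
  simp

lemma splits_of_retraction {ζ : E.ShortExtension X Y} {r : ζ.mid ⟶ Y} (hr : ζ.i ≫ r = 𝟙 Y) :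
    ζ.Splits := by
  obtain ⟨s, hs⟩ := ζ.exists_desc (𝟙 _ - r ≫ ζ.i) (by
    rw [Preadditive.comp_sub, reassoc_of% hr]; simp)
  have := ζ.epi_p
  refine ⟨s, ?_⟩
  rw [← cancel_epi ζ.p, reassoc_of% hs, Preadditive.sub_comp, Category.assoc, ζ.w]
  simp

/-- Sections transport forwards and retractions backwards along the middle map, so splitting is
invariant under the generated equivalence relation. -/
lemma Maps.splits_iff {ζ ζ' : E.ShortExtension X Y} (h : Maps (𝟙 Y) (𝟙 X) ζ ζ') :
    ζ.Splits ↔ ζ'.Splits := by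
  obtain ⟨m, h1, h2⟩ := h
  rw [Category.id_comp] at h1
  rw [Category.comp_id] at h2
  constructor
  · rintro ⟨s, hs⟩
    exact ⟨s ≫ m, by rw [Category.assoc, h2, hs]⟩
  · intro h
    obtain ⟨r, hr⟩ := h.exists_retraction
    exact splits_of_retraction (r := m ≫ r) (by rw [reassoc_of% h1, hr])

variable [HasBinaryBiproducts C] [HasZeroObject C]

/-- The conflation `B ⟶ B' ⊞ Z ⟶ Z'` of a morphism of conflations which is the identity on the
left. -/
noncomputable def ofMaps {Z' : C} (ζ : E.ShortExtension Z Y) (ζ' : E.ShortExtension Z' Y)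
    {m : ζ.mid ⟶ ζ'.mid} {c : Z ⟶ Z'} (hi : ζ.i ≫ m = ζ'.i) (hp : m ≫ ζ'.p = ζ.p ≫ c) :
    E.ShortExtension Z' ζ.mid where
  mid := ζ'.mid ⊞ Z
  i := biprod.lift m ζ.p
  p := biprod.desc ζ'.p (-c)
  w := by rw [biprod.lift_desc, hp, Preadditive.comp_neg, add_neg_cancel]
  conflation := by
    have sq := ζ.isPullback ζ' hi hp
    have hd : E.IsDeflation (biprod.desc ζ'.p (-c)) := by
      have : biprod.desc ζ'.p (-c) = (biprod.braiding _ _).hom ≫ biprod.desc (-c) ζ'.p := by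
        apply biprod.hom_ext' <;> simp
      rw [this]
      exact (isDeflation_of_iso E _).comp (ζ'.isDeflation.biprod_desc _)
    refine conflation_of_isDeflation _ hd ⟨fun f g h => sq.hom_ext ?_ ?_⟩ fun f hf => ?_
    · simpa using h =≫ biprod.fst
    · simpa using h =≫ biprod.snd
    · have hf' : (f ≫ biprod.fst) ≫ ζ'.p = (f ≫ biprod.snd) ≫ c := by
        rw [← sub_eq_zero, ← hf, Category.assoc, Category.assoc, ← Preadditive.comp_sub]
        congr 1
        apply biprod.hom_ext' <;> simp
      exact ⟨sq.lift _ _ hf', by apply biprod.hom_ext <;> simp⟩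

end ShortExtension

namespace Ext

open ShortExtension

variable {n : ℕ} {X Y Z : C}

variable [HasZeroObject C]

lemma mk_eq_zero_iff_splits (ζ : E.ShortExtension X Y) :
    (mk (n := 1) ζ : E.Ext 1 X Y) = zero E 1 X Y ↔ ζ.Splits := by
  let P : E.Ext 1 X Y → Prop := Quot.lift (fun ξ => ShortExtension.Splits E ξ) fun ξ ξ' h =>
    propext (Maps.splits_iff (Extension.maps_one_iff.1 h))
  have h0 : P (zero E 1 X Y) := by
    let ζ₀ := ShortExtension.ofSourceZero E X (isZero_zero C)
    change (ζ₀.push 0).Splits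
    refine ⟨ζ₀.toPush 0, ζ₀.toPush_p 0⟩
  refine ⟨fun h => ?_, fun ⟨s, hs⟩ => ?_⟩
  · change P (mk (n := 1) ζ)
    rwa [h]
  · refine (push_mk_eq (n := 1) ?_).symm
    exact ⟨s, (isZero_zero C).eq_of_src _ _, hs⟩

/-- Exactness at `Ext^n(X, B)`, as a property of the degree. -/
def MidExact (E : ExactStructure C) (n : ℕ) : Prop :=
  ∀ {X Y Z : C} (ζ : E.ShortExtension Z Y) (x : E.Ext n X ζ.mid), push ζ.p x = zero E n X Z →
    ∃ y : E.Ext n X Y, push ζ.i y = x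

/-- Exactness at `Ext^n(X, Z)`, as a property of the degree. -/
def DeltaExact (E : ExactStructure C) (n : ℕ) : Prop :=
  ∀ {X Y Z : C} (ζ : E.ShortExtension Z Y) (x : E.Ext n X Z), delta ζ x = zero E (n + 1) X Y →
    ∃ y : E.Ext n X ζ.mid, push ζ.p y = x

lemma zero_hom_iff (f : X ⟶ Y) : (mk (n := 0) ⟨f⟩ : E.Ext 0 X Y) = zero E 0 X Y ↔ f = 0 := by
  let P : E.Ext 0 X Y → (X ⟶ Y) := Quot.lift (fun ξ => ξ.down) fun ξ ξ' h =>
    (Category.comp_id _).symm.trans h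
  have h0 : P (zero E 0 X Y) = 0 := zero_comp
  refine ⟨fun h => ?_, fun h => ?_⟩
  · rw [← h0, ← h]; rfl
  · subst h
    exact congrArg (fun g => (mk (n := 0) ⟨g⟩ : E.Ext 0 X Y)) zero_comp.symm

lemma midExact_zero : MidExact E 0 := by
  intro X Y Z ζ x hx
  induction x using ind with | h ξ =>
  obtain ⟨g, hg⟩ := ζ.exists_lift ξ.down ((zero_hom_iff _).1 hx)
  exact ⟨mk (n := 0) ⟨g⟩, congrArg (fun f => (mk (n := 0) ⟨f⟩ : E.Ext 0 X ζ.mid)) hg⟩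

lemma deltaExact_zero : DeltaExact E 0 := by
  intro X Y Z ζ x hx
  induction x using ind with | h ξ =>
  obtain ⟨s, hs⟩ := (mk_eq_zero_iff_splits (ζ.pull ξ.down)).1 hx
  refine ⟨mk (n := 0) ⟨s ≫ ζ.fromPull ξ.down⟩,
    congrArg (fun f => (mk (n := 0) ⟨f⟩ : E.Ext 0 X Z)) ?_⟩
  change (s ≫ ζ.fromPull ξ.down) ≫ ζ.p = ξ.down
  rw [Category.assoc, (ζ.isPullback_pull ξ.down).w, reassoc_of% hs]

/-- Write the class as a connecting image along `β`. Its vanishing after pushing to `Z` lifts the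
tail to the middle of `β.push ζ.p`, and that middle is the cokernel of the composite inflation from
`Y`, which supplies the preimage. -/
lemma midExact_succ (h : DeltaExact E n) : MidExact E (n + 1) := by
  intro X Y Z ζ x hx
  obtain ⟨W, β, x', rfl⟩ := exists_delta x
  rw [push_delta (β.maps_push ζ.p), push_id] at hx
  obtain ⟨y, rfl⟩ := h _ _ hx
  refine ⟨delta (β.compPush ζ.conflation) y, push_delta (ζ' := β) ?_ y⟩
  exact ⟨𝟙 _, by simp [compPush], by simp [compPush, toPush_p]⟩

variable [HasBinaryBiproducts C]

lemma deltaExact_succ (hm : MidExact E (n + 1)) : DeltaExact E (n + 1) := by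
  intro X Y Z ζ x hx
  -- A class vanishes through a zigzag of morphisms, so a property is carried along it: the tail
  -- lifts through the middle term of the leftmost conflation. Going against a morphism, the pair of
  -- a lift and the old tail is killed in the conflation `ofMaps`, so it comes from a lift of the
  -- old tail.
  let P : E.Ext (n + 2) X Y → Prop := Quot.lift
    (fun ξ => ∃ y : E.Ext (n + 1) X ξ.2.1.mid, push ξ.2.1.p y = mk ξ.2.2) fun ξ ξ' h => by
      obtain ⟨c, ⟨m, h1, h2⟩, h3⟩ := Extension.maps_succ_iff.1 h
      have h3' := push_mk_eq h3
      rw [Category.id_comp] at h1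
      refine propext ⟨fun ⟨y, hy⟩ => ⟨push m y, ?_⟩, fun ⟨y, hy⟩ => ?_⟩
      · rw [← push_comp, h2, push_comp, hy, h3']
      · obtain ⟨z, hz⟩ := hm (ofMaps _ _ h1 h2) (pair y (mk ξ.2.2))
          (push_desc_pair (hy.trans h3'.symm))
        refine ⟨z, ?_⟩
        exact (congrArg (fun f => push f z) (biprod.lift_snd _ _)).symm.trans
          ((push_comp _ _ _).trans ((congrArg (push biprod.snd) hz).trans (push_snd_pair _ _)))
  have h0 : P (zero E (n + 2) X Y) :=
    ⟨zero E _ _ _, (subsingleton_of_isZero (n + 1) X (isZero_zero C)).elim _ _⟩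
  rw [← hx] at h0
  induction x using ind with | h ξ => exact h0

lemma exact : ∀ n : ℕ, MidExact E n ∧ DeltaExact E n
  | 0 => ⟨midExact_zero, deltaExact_zero⟩
  | n + 1 => ⟨midExact_succ (exact n).2, deltaExact_succ (midExact_succ (exact n).2)⟩

lemma exists_push_i (ζ : E.ShortExtension Z Y) (x : E.Ext n X ζ.mid)
    (hx : push ζ.p x = zero E n X Z) : ∃ y : E.Ext n X Y, push ζ.i y = x := (exact n).1 ζ x hx

lemma exists_push_p (ζ : E.ShortExtension Z Y) (x : E.Ext n X Z)
    (hx : delta ζ x = zero E (n + 1) X Y) : ∃ y : E.Ext n X ζ.mid, push ζ.p y = x :=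
  (exact n).2 ζ x hx

end Ext

variable [HasZeroObject C] {n : ℕ} {X Y Z : C}

lemma extVanishes_one_iff : E.ExtVanishes 1 X Y ↔ ∀ ζ : E.ShortExtension X Y, ζ.Splits := by
  rw [extVanishes_iff]
  refine ⟨fun h ζ => (Ext.mk_eq_zero_iff_splits ζ).1 (h _), fun h x => ?_⟩
  induction x using Ext.ind with | h ξ => exact (Ext.mk_eq_zero_iff_splits ξ).2 (h ξ)

namespace ShortExtension

section

variable [HasBinaryBiproducts C]

/-- Dimension shift: vanishing at the right end of a conflation. -/
lemma extVanishes_right (ζ : E.ShortExtension Z Y) (hB : E.ExtVanishes n X ζ.mid)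
    (hY : E.ExtVanishes (n + 1) X Y) : E.ExtVanishes n X Z := by
  rw [extVanishes_iff] at *
  intro x
  obtain ⟨y, rfl⟩ := Ext.exists_push_p ζ x (hY _)
  rw [hB y, Ext.push_zero]

/-- Dimension shift: vanishing at the left end of a conflation. -/
lemma extVanishes_left (ζ : E.ShortExtension Z Y) (hB : E.ExtVanishes (n + 1) X ζ.mid)
    (hZ : E.ExtVanishes n X Z) : E.ExtVanishes (n + 1) X Y := by
  rw [extVanishes_iff] at *
  intro x
  obtain ⟨W, α, x', rfl⟩ := Ext.exists_delta x
  obtain ⟨y, rfl⟩ := Ext.exists_push_p (α.push ζ.i) x' (by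
    have := Ext.push_delta (α.maps_push ζ.i) x'
    rw [Ext.push_id] at this
    rw [← this]
    exact hB _)
  -- The middle of the pushout is an extension of `Z` by `α.mid`. Since classes in `Z` vanish, the
  -- lift comes from `α.mid`, and the connecting map of `α` kills what comes from there.
  obtain ⟨r, w, -, hr⟩ := α.exists_toPush_conflation ζ
  obtain ⟨z, rfl⟩ := Ext.exists_push_i ⟨_, _, r, w, hr⟩ y (hZ _)
  dsimp only
  rw [← Ext.push_comp, toPush_p, Ext.delta_push_p]

end

/-- Dimension shift in degree one. -/
lemma extVanishes_one_left (ζ : E.ShortExtension Z Y) (hB : E.ExtVanishes 1 X ζ.mid)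
    (hZ : ∀ f : X ⟶ Z, ∃ g : X ⟶ ζ.mid, g ≫ ζ.p = f) : E.ExtVanishes 1 X Y := by
  rw [extVanishes_one_iff] at *
  intro α
  obtain ⟨r, hr⟩ := (hB (α.push ζ.i)).exists_retraction
  have hu : α.i ≫ α.toPush ζ.i ≫ r = ζ.i := by
    rw [(α.isPushout_push ζ.i).w_assoc, hr, Category.comp_id]
  obtain ⟨f, hf⟩ := α.exists_desc ((α.toPush ζ.i ≫ r) ≫ ζ.p) (by
    rw [← Category.assoc, hu, ζ.w])
  obtain ⟨g, rfl⟩ := hZ f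
  obtain ⟨t, ht⟩ := ζ.exists_lift (α.toPush ζ.i ≫ r - α.p ≫ g) (by
    rw [Preadditive.sub_comp, ← hf, Category.assoc, sub_self])
  have := ζ.mono_i
  refine splits_of_retraction (r := t) ?_
  rw [← cancel_mono ζ.i, Category.assoc, ht, Preadditive.comp_sub, hu, reassoc_of% α.w]
  simp

end ShortExtension

lemma ExtVanishes.exists_lift (h : E.ExtVanishes 1 X Y) (ζ : E.ShortExtension Z Y) (f : X ⟶ Z) :
    ∃ g : X ⟶ ζ.mid, g ≫ ζ.p = f := by
  obtain ⟨s, hs⟩ := extVanishes_one_iff.1 h (ζ.pull f)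
  exact ⟨s ≫ ζ.fromPull f, by
    rw [Category.assoc, (ζ.isPullback_pull f).w, reassoc_of% hs]⟩

end Exactness

end ExactStructure

namespace ExactStructure

/-! ### Computing Ext from projective resolutions. -/

section Resolutions

variable {C : Type u} [Category.{v} C] [Preadditive C] (E : ExactStructure C)

/-- Projectivity relative to an exact structure. -/
def IsProj (P : C) : Prop :=
  ∀ {Y Z : C} (ζ : E.ShortExtension Z Y) (f : P ⟶ Z), ∃ g : P ⟶ ζ.mid, g ≫ ζ.p = f

/-- Every object is a quotient of a relative projective. -/
def EnoughProj : Prop := ∀ X : C, ∃ (K : C) (κ : E.ShortExtension X K), E.IsProj κ.mid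

variable {E}

namespace ShortExtension

lemma exists_maps_of_isProj {X K X' Y : C} {κ : E.ShortExtension X K} (hκ : E.IsProj κ.mid)
    (ζ : E.ShortExtension X' Y) (a : X ⟶ X') : ∃ b : K ⟶ Y, Maps b a κ ζ := by
  obtain ⟨m, hm⟩ := hκ ζ (κ.p ≫ a)
  obtain ⟨b, hb⟩ := ζ.exists_lift (κ.i ≫ m) (by
    rw [Category.assoc, hm, reassoc_of% κ.w, zero_comp])
  exact ⟨b, m, hb.symm, hm⟩

lemma splits_push_iff {X K T : C} (κ : E.ShortExtension X K) (f : K ⟶ T) :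
    (κ.push f).Splits ↔ ∃ g : κ.mid ⟶ T, κ.i ≫ g = f := by
  have sq := κ.isPushout_push f
  constructor
  · intro h
    obtain ⟨r, hr⟩ := h.exists_retraction
    exact ⟨κ.toPush f ≫ r, by rw [sq.w_assoc, hr, Category.comp_id]⟩
  · rintro ⟨g, hg⟩
    exact splits_of_retraction (r := sq.desc g (𝟙 T) (by rw [hg, Category.comp_id]))
      (sq.inr_desc _ _ _)

end ShortExtension

namespace Extension

/-- All middle terms of an extension are projective. -/
def IsResolution : ∀ {n : ℕ} {X K : C}, E.Extension (n + 1) X K → Prop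
  | 0, _, _, π => E.IsProj (ShortExtension.mid (E := E) π)
  | _ + 1, _, _, π => E.IsProj π.2.1.mid ∧ IsResolution π.2.2

/-- A morphism out of the left end extends along the first morphism of an extension. -/
def Extends : ∀ {n : ℕ} {X K T : C}, E.Extension (n + 1) X K → (K ⟶ T) → Prop
  | 0, _, _, T, π, f => ∃ g : ShortExtension.mid (E := E) π ⟶ T, ShortExtension.i (E := E) π ≫ g = f
  | _ + 1, _, _, T, π, f => ∃ g : π.2.1.mid ⟶ T, π.2.1.i ≫ g = f

lemma IsResolution.exists_maps : ∀ {n : ℕ} {X K Y : C} {π : E.Extension (n + 1) X K},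
    π.IsResolution → ∀ ξ : E.Extension (n + 1) X Y, ∃ f : K ⟶ Y, Maps E (n + 1) f π ξ
  | 0, _, _, _, _, h, ξ => by
    obtain ⟨b, hb⟩ := ShortExtension.exists_maps_of_isProj h ξ (𝟙 _)
    exact ⟨b, maps_one_iff.2 hb⟩
  | _ + 1, _, _, _, _, h, ξ => by
    obtain ⟨c, hc⟩ := h.2.exists_maps ξ.2.2
    obtain ⟨b, hb⟩ := ShortExtension.exists_maps_of_isProj h.1 ξ.2.1 c
    exact ⟨b, maps_succ_iff.2 ⟨c, hb, hc⟩⟩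

lemma IsResolution.exists_factor : ∀ {n : ℕ} {X K T : C} {π : E.Extension (n + 1) X K},
    π.IsResolution → ∀ {f : K ⟶ T}, π.Extends f →
      ∃ (P : C) (i : K ⟶ P) (g : P ⟶ T), E.IsProj P ∧ i ≫ g = f
  | 0, _, _, _, _, h, _, ⟨g, hg⟩ => ⟨_, _, g, h, hg⟩
  | _ + 1, _, _, _, _, h, _, ⟨g, hg⟩ => ⟨_, _, g, h.1, hg⟩

/-- Splicing a conflation on the right end of an extension. -/
def splice : ∀ {n : ℕ} {X K L : C}, E.Extension (n + 1) K L → E.ShortExtension X K →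
    E.Extension (n + 2) X L
  | 0, _, K, _, ξ, κ => ⟨K, ξ, κ⟩
  | _ + 1, _, _, _, ξ, κ => ⟨ξ.1, ξ.2.1, splice ξ.2.2 κ⟩

lemma IsResolution.splice : ∀ {n : ℕ} {X K L : C} {π : E.Extension (n + 1) K L}
    {κ : E.ShortExtension X K}, π.IsResolution → E.IsProj κ.mid →
      IsResolution (n := n + 1) (Extension.splice π κ)
  | 0, _, _, _, _, _, h, hκ => ⟨h, hκ⟩
  | _ + 1, _, _, _, _, _, h, hκ => ⟨h.1, h.2.splice hκ⟩

lemma extends_splice_iff : ∀ {n : ℕ} {X K L T : C} {π : E.Extension (n + 1) K L}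
    {κ : E.ShortExtension X K} {f : L ⟶ T},
      Extends (n := n + 1) (Extension.splice π κ) f ↔ π.Extends f
  | 0, _, _, _, _, _, _, _ => Iff.rfl
  | _ + 1, _, _, _, _, _, _, _ => Iff.rfl

lemma exists_isResolution (hE : E.EnoughProj) : ∀ (n : ℕ) (X : C),
    ∃ (K : C) (π : E.Extension (n + 1) X K), π.IsResolution
  | 0, X => hE X
  | n + 1, X => by
    obtain ⟨K, π, hπ⟩ := exists_isResolution hE n X
    obtain ⟨L, κ, hκ⟩ := hE K
    exact ⟨L, ⟨K, κ, π⟩, hκ, hπ⟩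

section

variable [HasZeroObject C]

lemma Extends.push_eq_zero : ∀ {n : ℕ} {X K T : C} {π : E.Extension (n + 1) X K} {f : K ⟶ T},
    π.Extends f → Ext.push f (Ext.mk π) = Ext.zero E (n + 1) X T
  | 0, _, _, _, π, f, h =>
    (Ext.mk_eq_zero_iff_splits _).2 ((ShortExtension.splits_push_iff (E := E) π f).2 h)
  | n + 1, X, _, _, π, f, h => by
    obtain ⟨s, hs⟩ := (π.2.1.splits_push_iff f).2 h
    change Ext.delta (π.2.1.push f) (Ext.mk π.2.2) = _
    rw [← Ext.delta_push_p (π.2.1.push f) (Ext.push s (Ext.mk π.2.2)), ← Ext.push_comp, hs,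
      Ext.push_id]

variable [HasBinaryBiproducts C]

/-- By exactness the tail of `π` lifts to the middle of the pushed conflation, and the lift is
induced by some `u`, as the tail is a resolution. Then `𝟙 - u ≫ p` kills the tail, so by induction
it factors through a projective, which lifts; adding that lift to `u` yields a section. -/
lemma IsResolution.extends_of_push_eq_zero : ∀ {n : ℕ} {X K T : C} {π : E.Extension (n + 1) X K}
    {f : K ⟶ T}, π.IsResolution → Ext.push f (Ext.mk π) = Ext.zero E (n + 1) X T → π.Extends f
  | 0, _, _, _, π, f, _, h =>
    (ShortExtension.splits_push_iff (E := E) π f).1 ((Ext.mk_eq_zero_iff_splits _).1 h)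
  | n + 1, X, K, T, π, f, hπ, h => by
    refine (π.2.1.splits_push_iff f).1 ?_
    obtain ⟨y, hy⟩ := Ext.exists_push_p (π.2.1.push f) (Ext.mk π.2.2) h
    induction y using Ext.ind with | h ξ =>
    obtain ⟨u, hu⟩ := hπ.2.exists_maps ξ
    rw [← Ext.push_mk_eq hu, ← Ext.push_comp] at hy
    have h0 := Ext.push_sub_eq_zero ((Ext.push_id _).trans hy.symm)
    obtain ⟨P, i, g, hP, hg⟩ := hπ.2.exists_factor (hπ.2.extends_of_push_eq_zero h0)
    obtain ⟨k, hk⟩ := hP (π.2.1.push f) g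
    exact ⟨u + i ≫ k, by rw [Preadditive.add_comp, Category.assoc, hk, hg, add_sub_cancel]⟩

/-- `Ext` groups computed from a projective resolution. -/
lemma IsResolution.extVanishes_iff {n : ℕ} {X K T : C} {π : E.Extension (n + 1) X K}
    (hπ : π.IsResolution) : E.ExtVanishes (n + 1) X T ↔ ∀ f : K ⟶ T, π.Extends f := by
  rw [ExactStructure.extVanishes_iff]
  refine ⟨fun h f => hπ.extends_of_push_eq_zero (h _), fun h x => ?_⟩
  induction x using Ext.ind with | h ξ =>
  obtain ⟨f, hf⟩ := hπ.exists_maps ξ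
  rw [← Ext.push_mk_eq hf, (h f).push_eq_zero]

end

end Extension

section

variable [HasZeroObject C]

lemma IsProj.extVanishes {P : C} (hP : E.IsProj P) : ∀ (n : ℕ) (Y : C), E.ExtVanishes (n + 1) P Y
  | 0, _ => ExactStructure.extVanishes_one_iff.2 fun ζ => hP ζ (𝟙 P)
  | n + 1, Y => by
    rw [extVanishes_iff]
    intro x
    obtain ⟨Z, ζ, x', rfl⟩ := Ext.exists_delta x
    rw [extVanishes_iff.1 (hP.extVanishes n Z) x', Ext.delta_zero]

variable [HasBinaryBiproducts C]

lemma ShortExtension.extVanishes_one_iff {X K T : C} {κ : E.ShortExtension X K}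
    (hκ : E.IsProj κ.mid) :
    E.ExtVanishes 1 X T ↔ ∀ f : K ⟶ T, ∃ g : κ.mid ⟶ T, κ.i ≫ g = f :=
  Extension.IsResolution.extVanishes_iff (n := 0) (π := κ) hκ

/-- Dimension shift along a conflation with projective middle term. -/
lemma ShortExtension.extVanishes_shift (hE : E.EnoughProj) {n : ℕ} {X K T : C}
    {κ : E.ShortExtension X K} (hκ : E.IsProj κ.mid) :
    E.ExtVanishes (n + 1) K T ↔ E.ExtVanishes (n + 2) X T := by
  obtain ⟨L, π, hπ⟩ := Extension.exists_isResolution hE n K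
  -- Splicing leaves the left end of the resolution untouched, so both vanishing statements are the
  -- same extension problem for morphisms.
  rw [hπ.extVanishes_iff, (hπ.splice hκ).extVanishes_iff]
  exact forall_congr' fun f => Extension.extends_splice_iff.symm

end

end Resolutions

end ExactStructure

namespace ExactStructure

/-! ### The relative structure, its comparison with `E`, and the two perpendicular categories. -/

section Relative

variable {C : Type u} [Category.{v} C] [Preadditive C] {E : ExactStructure C}
  {M : ObjectProperty C}

/-- A relative conflation, as a conflation. -/
def ShortExtension.ofRelative {X Y : C} (ζ : (E.relative M).ShortExtension X Y) :
    E.ShortExtension X Y := ⟨ζ.mid, ζ.i, ζ.p, ζ.w, ζ.conflation.1⟩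

/-- A conflation which stays exact under `Hom(T, -)` for `T` in `M`, as a relative conflation. -/
def ShortExtension.toRelative {X Y : C} (ζ : E.ShortExtension X Y)
    (h : ∀ T : C, M T → ∀ f : T ⟶ X, ∃ g : T ⟶ ζ.mid, g ≫ ζ.p = f) :
    (E.relative M).ShortExtension X Y := ⟨ζ.mid, ζ.i, ζ.p, ζ.w, ζ.conflation, h⟩

lemma isProj_relative {T : C} (hT : M T) : (E.relative M).IsProj T :=
  fun ζ f => ζ.conflation.2 T hT f

/-- Embedding the middle term into `M` allows any Yoneda class to be rewritten with its leftmost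
middle term in `M`. -/
lemma IsCogenerating.exists_maps (hcogen : E.IsCogenerating M) {Z Y : C}
    (ζ : E.ShortExtension Z Y) : ∃ (W : C) (ζ' : E.ShortExtension W Y) (c : Z ⟶ W),
      M ζ'.mid ∧ ShortExtension.Maps (𝟙 Y) c ζ ζ' := by
  obtain ⟨A, j, hA, hj⟩ := hcogen ζ.mid
  obtain ⟨W, q, w, h⟩ := IsInflation.comp ζ.isInflation hj
  obtain ⟨c, hc⟩ := ζ.exists_desc (j ≫ q) (by rw [← Category.assoc, w])
  exact ⟨W, ⟨A, _, q, w, h⟩, c, hA, j, (Category.id_comp _).symm, hc.symm⟩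

lemma IsRigid.rightPerp {n : ℕ} (hr : E.IsRigid n M) {N : C} (hN : M N) :
    E.rightPerp (n - 1) M N := fun T hT i h1 h2 => hr i h1 (by omega) T N hT hN

lemma rightPerp.exists_lift [HasZeroObject C] {k : ℕ} {Y : C} (hY : E.rightPerp (k + 1) M Y) {X : C}
    (ζ : E.ShortExtension X Y) (T : C) (hT : M T) (f : T ⟶ X) :
    ∃ g : T ⟶ ζ.mid, g ≫ ζ.p = f :=
  (hY T hT 1 le_rfl (by omega)).exists_lift ζ f

variable [HasBinaryBiproducts C]

lemma exists_relative_deflation [HasZeroObject C] (hM : IsAdditiveSubcategory M)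
    (hgen : E.IsGenerating M) (hfin : IsContravariantlyFinite M) (X : C) :
    ∃ (K : C) (κ : (E.relative M).ShortExtension X K), M κ.mid := by
  obtain ⟨A, f, hA, hf⟩ := hfin X
  obtain ⟨B, p, hB, hp⟩ := hgen X
  -- Adding a generating deflation to a right approximation gives a map that is both.
  obtain ⟨K, i, w, h⟩ := (hp.biprod_desc f).exists_shortExtension
  refine ⟨K, ShortExtension.toRelative ⟨_, i, _, w, h⟩ fun T hT g => ?_, hM.biprod hA hB⟩
  obtain ⟨k, hk⟩ := hf T hT g
  exact ⟨k ≫ biprod.inl, by simpa using hk⟩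

lemma exists_inflation_leftApprox [HasZeroObject C] (hM : IsAdditiveSubcategory M)
    (hcogen : E.IsCogenerating M) (hfin : IsCovariantlyFinite M) (X : C) :
    ∃ (X' : C) (ζ : E.ShortExtension X' X), M ζ.mid ∧
      ∀ T : C, M T → ∀ f : X ⟶ T, ∃ g : ζ.mid ⟶ T, ζ.i ≫ g = f := by
  obtain ⟨A, f, hA, hf⟩ := hfin X
  obtain ⟨B, i, hB, hi⟩ := hcogen X
  obtain ⟨X', p, w, h⟩ := hi.biprod_lift f
  refine ⟨X', ⟨_, _, p, w, h⟩, hM.biprod hA hB, fun T hT g => ?_⟩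
  obtain ⟨k, hk⟩ := hf T hT g
  exact ⟨biprod.fst ≫ k, by simpa using hk⟩

lemma enoughProj_relative [HasZeroObject C] (hM : IsAdditiveSubcategory M)
    (hgen : E.IsGenerating M) (hfin : IsContravariantlyFinite M) :
    (E.relative M).EnoughProj := fun X =>
  let ⟨K, κ, hκ⟩ := exists_relative_deflation hM hgen hfin X
  ⟨K, κ, isProj_relative hκ⟩

variable [HasZeroObject C]

/-- Rigidity kills the middle term, so each degree of `K` is controlled by the preceding degree of
`X`; in degree one it is F-exactness that provides the vanishing. Hence the gain of one degree. -/
lemma ShortExtension.rightPerp_left {n k : ℕ} (hr : E.IsRigid n M) {X K : C}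
    (κ : (E.relative M).ShortExtension X K) (hκ : M κ.mid) (hk : k + 1 < n)
    (hX : E.rightPerp k M X) : E.rightPerp (k + 1) M K := by
  intro T hT i h1 h2
  have hmid : E.ExtVanishes i T κ.mid := hr i h1 (by omega) T _ hT hκ
  match i with
  | 1 => exact κ.ofRelative.extVanishes_one_left hmid (κ.conflation.2 T hT)
  | i + 2 => exact κ.ofRelative.extVanishes_left hmid (hX T hT (i + 1) (by omega) (by omega))

lemma ShortExtension.rightPerp_right {n k : ℕ} (hr : E.IsRigid n M) {X X' : C}
    (ζ : E.ShortExtension X' X) (hζ : M ζ.mid) (hk : k < n)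
    (hX : E.rightPerp (k + 1) M X) : E.rightPerp k M X' := fun T hT i h1 h2 =>
  ζ.extVanishes_right (hr i h1 (by omega) T _ hT hζ) (hX T hT (i + 1) (by omega) (by omega))

/-- In degree one, all conflations starting at `Y` are relative. In higher degrees, move the class
onto a conflation with middle term in `M`; it is relative too, so the hypotheses pass to its
cokernel `W` in one degree less. -/
lemma extVanishes_of_relative {n : ℕ} (hr : E.IsRigid n M) (hcogen : E.IsCogenerating M) {X : C} :
    ∀ {i : ℕ} {Y : C}, i + 1 < n → E.rightPerp (i + 1) M Y → (E.relative M).leftPerp i M X →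
      (E.relative M).ExtVanishes (i + 1) X Y → E.ExtVanishes (i + 1) X Y
  | 0, _, _, hY, _, h => extVanishes_one_iff.2 fun ζ =>
    extVanishes_one_iff.1 h (ζ.toRelative (hY.exists_lift ζ))
  | i + 1, Y, hi, hY, hX, h => by
    rw [extVanishes_iff]
    intro x
    obtain ⟨Z, ζ, x', rfl⟩ := Ext.exists_delta x
    obtain ⟨W, ζ', c, hζ', hc⟩ := hcogen.exists_maps ζ
    have hW := (ζ'.toRelative (hY.exists_lift ζ')).extVanishes_right
      (hX _ hζ' (i + 1) (by omega) le_rfl) h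
    have := extVanishes_of_relative hr hcogen (by omega)
      (ζ'.rightPerp_right hr hζ' (by omega) hY)
      (fun T hT j h1 h2 => hX T hT j h1 (by omega)) hW
    rw [← Ext.push_id (Ext.delta ζ x'), Ext.push_delta hc, extVanishes_iff.1 this (Ext.push c x'),
      Ext.delta_zero]

/-- The same induction with the dimension shift made in `E`; orthogonality of `Y` serves to make the
replacing conflation relative. -/
lemma relative_extVanishes {n : ℕ} (hr : E.IsRigid n M) (hcogen : E.IsCogenerating M) {X : C} :
    ∀ {i : ℕ} {Y : C}, i + 1 < n → E.rightPerp (i + 1) M Y → E.leftPerp i M X →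
      E.ExtVanishes (i + 1) X Y → (E.relative M).ExtVanishes (i + 1) X Y
  | 0, _, _, _, _, h => extVanishes_one_iff.2 fun ζ => extVanishes_one_iff.1 h ζ.ofRelative
  | i + 1, Y, hi, hY, hX, h => by
    rw [extVanishes_iff]
    intro x
    obtain ⟨Z, ζ, x', rfl⟩ := Ext.exists_delta x
    obtain ⟨W, ζ', c, hζ', m, h1, h2⟩ := hcogen.exists_maps ζ.ofRelative
    have hW := ζ'.extVanishes_right (hX _ hζ' (i + 1) (by omega) le_rfl) h
    have := relative_extVanishes hr hcogen (by omega)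
      (ζ'.rightPerp_right hr hζ' (by omega) hY)
      (fun T hT j h1 h2 => hX T hT j h1 (by omega)) hW
    have hc : ShortExtension.Maps (𝟙 Y) c ζ (ζ'.toRelative (hY.exists_lift ζ')) := ⟨m, h1, h2⟩
    rw [← Ext.push_id (Ext.delta ζ x'), Ext.push_delta hc, extVanishes_iff.1 this (Ext.push c x'),
      Ext.delta_zero]

lemma leftPerp_of_relative {n : ℕ} (hr : E.IsRigid n M) (hcogen : E.IsCogenerating M) {X : C}
    (hX : (E.relative M).leftPerp (n - 1) M X) : E.leftPerp (n - 1) M X := by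
  rintro T hT (_ | i) h1 h2
  · omega
  · exact extVanishes_of_relative hr hcogen (by omega)
      (fun S hS j h3 h4 => hr.rightPerp hT S hS j h3 (by omega))
      (fun S hS j h3 h4 => hX S hS j h3 (by omega)) (hX T hT (i + 1) h1 h2)

lemma relative_leftPerp {n : ℕ} (hr : E.IsRigid n M) (hcogen : E.IsCogenerating M) {X : C}
    (hX : E.leftPerp (n - 1) M X) : (E.relative M).leftPerp (n - 1) M X := by
  rintro T hT (_ | i) h1 h2
  · omega
  · exact relative_extVanishes hr hcogen (by omega)
      (fun S hS j h3 h4 => hr.rightPerp hT S hS j h3 (by omega))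
      (fun S hS j h3 h4 => hX S hS j h3 (by omega)) (hX T hT (i + 1) h1 h2)

/-- If `⊥M = M⊥`, then the objects of `M` have relative injective dimension less than `n`. -/
lemma relative_hasInjDimLT_of_leftPerp_eq {n : ℕ} (hn : 1 < n) (hM : IsAdditiveSubcategory M)
    (hgen : E.IsGenerating M) (hcogen : E.IsCogenerating M) (hfin : IsContravariantlyFinite M)
    (hr : E.IsRigid n M) (h : E.leftPerp (n - 1) M = E.rightPerp (n - 1) M) {T : C} (hT : M T) :
    (E.relative M).HasInjDimLT T n := by
  have hE := enoughProj_relative hM hgen hfin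
  -- Here `d` is the number of syzygies still needed to reach full right orthogonality. Starting
  -- with `k = 0`, where nothing is assumed of `X`, gives degree `n`.
  have key : ∀ (d k : ℕ) (X : C), k + d = n - 1 → E.rightPerp k M X →
      (E.relative M).ExtVanishes (d + 1) X T := by
    intro d
    induction d with
    | zero =>
      intro k X hk hX
      obtain rfl : k = n - 1 := hk
      rw [← h] at hX
      exact relative_leftPerp hr hcogen hX T hT 1 le_rfl (by omega)
    | succ d ih =>
      intro k X hk hX
      obtain ⟨K, κ, hκ⟩ := exists_relative_deflation hM hgen hfin X
      exact (κ.extVanishes_shift hE (isProj_relative hκ)).1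
        (ih (k + 1) K (by omega) (κ.rightPerp_left hr hκ (by omega) hX))
  intro i hi
  induction i, hi using Nat.le_induction with
  | base =>
    intro X
    have := key (n - 1) 0 X (by omega) fun S hS i h1 h2 => by omega
    rwa [Nat.sub_add_cancel (by omega)] at this
  | succ i hi ih =>
    intro X
    obtain ⟨K, κ, hκ⟩ := exists_relative_deflation hM hgen hfin X
    obtain ⟨j, rfl⟩ : ∃ j, i = j + 1 := ⟨i - 1, by omega⟩
    exact (κ.extVanishes_shift hE (isProj_relative hκ)).1 (ih K)

/-- If `⊥M = M⊥`, then `M` is relatively cotilting. -/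
lemma relative_isCotilting_of_leftPerp_eq {n : ℕ} (hn : 1 < n) (hM : IsAdditiveSubcategory M)
    (hgen : E.IsGenerating M) (hcogen : E.IsCogenerating M) (hfin : IsFunctoriallyFinite M)
    (hr : E.IsRigid n M) (h : E.leftPerp (n - 1) M = E.rightPerp (n - 1) M) :
    (E.relative M).IsCotilting (n - 1) M where
  functoriallyFinite := hfin
  injDim_le T hT := by
    rw [Nat.sub_add_cancel (by omega)]
    exact relative_hasInjDimLT_of_leftPerp_eq hn hM hgen hcogen hfin.1 hr h hT
  le_leftPerpInf T hT := by
    rintro S - (_ | i) hi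
    · omega
    · exact IsProj.extVanishes (isProj_relative hT) i S
  cogenerator X hX := by
    have hX' : E.rightPerp (n - 1 - 1 + 1) M X := by
      rw [Nat.sub_add_cancel (by omega), ← h]
      exact leftPerp_of_relative hr hcogen fun S hS i h1 _ => hX S hS i h1
    obtain ⟨X', ζ, hζ, hl⟩ := exists_inflation_leftApprox hM hcogen hfin.2 X
    let ω := ζ.toRelative (hX'.exists_lift ζ)
    have hω : (E.relative M).IsProj ω.mid := isProj_relative hζ
    refine ⟨ω.mid, X', ω.i, ω.p, ω.w, ω.conflation, hζ, ?_⟩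
    rintro S hS (_ | _ | i) hi
    · omega
    -- Since the middle term is relatively projective, vanishing in degree one is exactly the left
    -- approximation property.
    · exact (ShortExtension.extVanishes_one_iff hω).2 (hl S hS)
    · exact (ω.extVanishes_shift (enoughProj_relative hM hgen hfin.1) hω).1
        (hX S hS (i + 1) (by omega))

/-- If `M` is relatively cotilting, then `⊥M ⊆ M⊥`. -/
lemma rightPerp_of_leftPerpInf {n : ℕ} (hr : E.IsRigid n M) {m : ℕ}
    (hcot : (E.relative M).IsCotilting m M) : ∀ (k : ℕ), k < n → ∀ {X : C},
      (E.relative M).leftPerpInf M X → E.rightPerp k M X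
  | 0, _, _, _ => fun _ _ i h1 h2 => by omega
  | k + 1, hk, X, hX => by
    -- The cokernel `X'` stays in the relative perpendicular category, so the induction applies to
    -- it, and its syzygy `X` gains the missing degree.
    obtain ⟨N, X', i, p, w, hc, hN, hX'⟩ := hcot.cogenerator X hX
    exact ShortExtension.rightPerp_left (k := k) hr ⟨N, i, p, w, hc⟩ hN hk
      (rightPerp_of_leftPerpInf hr hcot k (by omega) hX')

/-- If the objects of `M` have relative injective dimension less than `n`, then objects of `M⊥`
have vanishing relative extensions by `M` in correspondingly high degrees. -/
lemma relative_extVanishes_of_rightPerp {n : ℕ} (hM : IsAdditiveSubcategory M)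
    (hgen : E.IsGenerating M) (hcogen : E.IsCogenerating M) (hfin : IsContravariantlyFinite M)
    (hr : E.IsRigid n M) {T : C} (hinj : (E.relative M).HasInjDimLT T n) : ∀ (k : ℕ), k < n →
      ∀ {X : C}, E.rightPerp k M X → ∀ i, n ≤ i + 1 + k → (E.relative M).ExtVanishes (i + 1) X T
  | 0, _, X, _ => fun i hi => hinj (i + 1) hi X
  | k + 1, hk, X, hX => fun i hi => by
    -- Passing to the cosyzygy lowers `k` and raises the degree by one, preserving the bound `n ≤ i
    -- + 1 + k`; at `k = 0` the injective dimension takes over.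
    obtain ⟨A, j, hA, X', p, w, h⟩ := hcogen X
    let ζ : E.ShortExtension X' X := ⟨A, j, p, w, h⟩
    have hζ : (E.relative M).IsProj (ζ.toRelative (hX.exists_lift ζ)).mid := isProj_relative hA
    exact (ShortExtension.extVanishes_shift (enoughProj_relative hM hgen hfin) hζ).2
      (relative_extVanishes_of_rightPerp hM hgen hcogen hfin hr hinj k (by omega)
        (ζ.rightPerp_right hr hA (by omega) hX) (i + 1) (by omega))

end Relative

end ExactStructure

theorem mainTheorem8 {C : Type u} [Category.{v} C] [Preadditive C] [HasZeroObject C]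
    [HasBinaryBiproducts C] (E : ExactStructure C) (M : ObjectProperty C)
    (hM : IsAdditiveSubcategory M) (n : ℕ) (hn : 1 < n)
    (hgen : E.IsGenerating M) (hcogen : E.IsCogenerating M)
    (hfin : IsFunctoriallyFinite M) (hrigid : E.IsRigid n M) :
    E.leftPerp (n - 1) M = E.rightPerp (n - 1) M ↔ E.IsPreclusterTilting n M := by
  constructor
  · intro h
    exact
      { generating := hgen
        cogenerating := hcogen
        contravariantlyFinite := hfin.1
        covariantlyFinite := hfin.2
        rigid := hrigid
        relative_injDim_lt := fun _ hT => ExactStructure.relative_hasInjDimLT_of_leftPerp_eq hn hM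
          hgen hcogen hfin.1 hrigid h hT
        relative_cotilting := ⟨n - 1, ExactStructure.relative_isCotilting_of_leftPerp_eq hn hM hgen
          hcogen hfin hrigid h⟩ }
  · intro h
    obtain ⟨m, hcot⟩ := h.relative_cotilting
    funext X
    refine propext ⟨fun hX => ?_, fun hX => ?_⟩
    · refine ExactStructure.rightPerp_of_leftPerpInf hrigid hcot (n - 1) (by omega) fun S hS i h1 => ?_
      rcases lt_or_ge i n with hi | hi
      · exact ExactStructure.relative_leftPerp hrigid hcogen hX S hS i h1 (by omega)
      · exact h.relative_injDim_lt S hS i hi X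
    · refine ExactStructure.leftPerp_of_relative hrigid hcogen ?_
      rintro T hT (_ | i) h1 _
      · omega
      -- With `k = n - 1` the bound holds for every `i`, so all positive degrees vanish.
      · exact ExactStructure.relative_extVanishes_of_rightPerp hM hgen hcogen hfin.1 hrigid
          (h.relative_injDim_lt T hT) (n - 1) (by omega) hX i (by omega)
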